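/- Let $G=(V,E)$ be a finite $k$-uniform hypergraph ($E$ is a set of $k$-element subsets of $V$), and let $r,p,x$ be integers with $2\le p\le k$, $p\le r$ and $x\ge 1$. An $r$-coloring of $V$ properly $(r,p)$ colors a hyperedge $e$ if at least $\min(p,|e|)$ distinct colors occur on $e$. A strong $(r,p)$ cover of $G$ is a set of $r$-colorings of $V$ such that every hyperedge is properly $(r,p)$ colored by at least one of them, and $\chi^c(G,k,r,p)$ is the minimum size of a strong $(r,p)$ cover. The dependency of a hyperedge is the number of other hyperedges with which it shares at least one vertex, and $d(G)$ is the maximum dependency of a hyperedge ($0$ if $E=\emptyset$). Suppose that $$d(G)\le \frac1e\left(\frac{r^k}{(p-1)^k\binom{r}{p-1}}\right)^x-1 .$$ Then the following hold. 1. $\chi^c(G,k,r,p)\le x$. 2. Consider Algorithm MTC: color all vertices in $x$ colorings independently and uniformly at random with $r$ colors; while some hyperedge is properly $(r,p)$ colored by none of the $x$ colorings, pick an arbitrary such hyperedge $e$ and draw new independent uniform colors for all vertices of $e$ in all $x$ colorings. There is a polynomial $q$, independent of $G,k,r,p,x$, such that for every rule for picking the violated hyperedges (which may depend on the whole history) the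 expected number of resampling rounds is at most $q(N)$, where $N=|V|+|E|+x+\ell(r)$ and $\ell(r)$ is the number of binary digits of $r$. 3. Such a cover can be computed in randomized polynomial time: there are one program $M$ for a random access machine with fair coin flips (unit-cost steps; addition, truncated subtraction and comparison as the only arithmetic) and one polynomial $q$ such that, on every instance as above with $V=\{0,\dots,n-1\}$, given by $n,|E|,k,r,p,x$ and the hyperedges listed in any order, the expected number of steps of $M$ is at most $q(N)$, and whenever $M$ halts, its output is a family of $x$ $r$-colorings (repetitions allowed) that is a strong $(r,p)$ cover of $G$. -/

import Mathlib

open scoped ENNReal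

/-! ### Strong covers of hypergraphs

A finite hypergraph on the vertex type `V` is given by its set of hyperedges
`E : Finset (Finset V)`; an `r`-coloring of the vertices is a map `V → Fin r`. -/

section Covers

variable {V : Type*} [DecidableEq V]

/-- The hyperedge `e` is properly `(r,p)` colored by `c`:
at least `min p |e|` distinct colors occur on `e`. -/
def ProperlyColored {r : ℕ} (p : ℕ) (c : V → Fin r) (e : Finset V) : Prop :=
  min p e.card ≤ (e.image c).card

/-- `C` is a strong `(r,p)` cover: every hyperedge is properly `(r,p)` colored by at least one of
the `r`-colorings in `C`. -/
def IsStrongCover {r : ℕ} (E : Finset (Finset V)) (p : ℕ) (C : Set (V → Fin r)) : Prop :=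
  ∀ e ∈ E, ∃ c ∈ C, ProperlyColored p c e

/-- The strong `(r,p)` cover number: the least size of a strong `(r,p)` cover
(`⊤` if there is none). -/
noncomputable def strongCoverNumber (E : Finset (Finset V)) (r p : ℕ) : ℕ∞ :=
  ⨅ (C : Set (V → Fin r)) (_ : IsStrongCover E p C), C.encard

/-- The dependency of `e`: the number of other hyperedges sharing a vertex with `e`. -/
def edgeDependency (E : Finset (Finset V)) (e : Finset V) : ℕ :=
  (E.filter fun f => f ≠ e ∧ (e ∩ f).Nonempty).card

/-- The dependency of the hypergraph: the maximum dependency of a hyperedge. -/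
def dependency (E : Finset (Finset V)) : ℕ :=
  E.sup (edgeDependency E)

/-- `E` is the hyperedge set of a `k`-uniform hypergraph, the parameters are in the admissible
range, and the dependency is at most `(1/e) (r^k / ((p-1)^k C(r,p-1)))^x - 1`. -/
structure DependencyCondition (E : Finset (Finset V)) (k r p x : ℕ) : Prop where
  uniform : ∀ e ∈ E, e.card = k
  two_le_p : 2 ≤ p
  p_le_k : p ≤ k
  p_le_r : p ≤ r
  one_le_x : 1 ≤ x
  dependency_le : (dependency E : ℝ) ≤
    1 / Real.exp 1 * ((r : ℝ) ^ k / (((p : ℝ) - 1) ^ k * (r.choose (p - 1) : ℝ))) ^ x - 1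

end Covers

/-- The size of an instance with `n` vertices and `m` hyperedges, when `x` colorings with `r` colors
are sought; `r` is counted by its binary length. -/
def instanceSize (n m x r : ℕ) : ℕ := n + m + x + r.size

/-! ### Algorithm MTC -/

namespace MTC

variable {V : Type*} [Fintype V] [DecidableEq V] {r x : ℕ}

/-- The hyperedges whose bad event happens: no coloring of the family `X` colors them properly. -/
noncomputable def violated (E : Finset (Finset V)) (p : ℕ) (X : Fin x → V → Fin r) :
    Finset (Finset V) :=
  open Classical in E.filter fun e => ∀ i, ¬ ProperlyColored p (X i) e

/-- Draw new independent uniform colors for all vertices of `e` in all `x` colorings, and keep the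
colors of all other vertices. -/
noncomputable def resample [NeZero r] (e : Finset V) (X : Fin x → V → Fin r) :
    PMF (Fin x → V → Fin r) :=
  (PMF.uniformOfFintype (Fin x → V → Fin r)).map fun Y i v => if v ∈ e then Y i v else X i v

/-- A way of picking a violated hyperedge, which may depend on the current family `X` of colorings
and on the list `h` of all earlier families. -/
def IsSelectionRule (E : Finset (Finset V)) (p : ℕ)
    (pick : List (Fin x → V → Fin r) → (Fin x → V → Fin r) → Finset V) : Prop :=
  ∀ h X, (violated E p X).Nonempty → pick h X ∈ violated E p X

/-- One test of the loop condition: if some hyperedge is violated, then the picked one is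
resampled; otherwise the algorithm has stopped, and nothing changes any more. -/
noncomputable def round [NeZero r] (E : Finset (Finset V)) (p : ℕ)
    (pick : List (Fin x → V → Fin r) → (Fin x → V → Fin r) → Finset V)
    (S : List (Fin x → V → Fin r) × (Fin x → V → Fin r)) :
    PMF (List (Fin x → V → Fin r) × (Fin x → V → Fin r)) :=
  open Classical in
  if (violated E p S.2).Nonempty then
    (resample (pick S.1 S.2) S.2).map fun Y => (S.2 :: S.1, Y)
  else PMF.pure S

/-- The history and the current colorings after `t` rounds, from independent uniform colors. -/
noncomputable def state [NeZero r] (E : Finset (Finset V)) (p : ℕ)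
    (pick : List (Fin x → V → Fin r) → (Fin x → V → Fin r) → Finset V) :
    ℕ → PMF (List (Fin x → V → Fin r) × (Fin x → V → Fin r))
  | 0 => (PMF.uniformOfFintype (Fin x → V → Fin r)).map fun X => ([], X)
  | t + 1 => (state E p pick t).bind (round E p pick)

/-- The expected number `𝔼 T = ∑ₜ ℙ(T > t)` of resampling rounds before the algorithm stops with a
strong cover (infinite if it runs forever with positive probability). -/
noncomputable def expectedRounds [NeZero r] (E : Finset (Finset V)) (p : ℕ)
    (pick : List (Fin x → V → Fin r) → (Fin x → V → Fin r) → Finset V) : ℝ≥0∞ :=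
  ∑' t : ℕ, (state E p pick t).toOuterMeasure {S | ¬ IsStrongCover E p (Set.range S.2)}

end MTC

/-! ### A coin-flipping random access machine

Programs have registers and an indirectly addressed memory, both holding natural numbers. Every
elementary command, every test and every sequencing counts as one step. Addition and truncated
subtraction are the only arithmetic operations, so one step of a given program lengthens the binary
representations in use by at most a constant number of bits, and the step count is polynomially
related to the running time of a probabilistic Turing machine. -/

namespace RAM

/-- Expressions: constants, registers, memory cells, sums, truncated differences. -/
inductive Expr where
  | lit (c : ℕ)
  | reg (i : ℕ)
  | load (a : Expr)
  | plus (a b : Expr)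
  | minus (a b : Expr)

/-- Programs. The tests are of the form `a < b`. -/
inductive Cmd where
  | assign (i : ℕ) (a : Expr)
  | store (a b : Expr)
  | flip (i : ℕ)
  | seq (c d : Cmd)
  | ite (a b : Expr) (c d : Cmd)
  | while (a b : Expr) (c : Cmd)

/-- The contents of the registers and of the memory. -/
structure Store where
  reg : ℕ → ℕ
  mem : ℕ → ℕ

/-- The value of an expression. -/
def Expr.eval (s : Store) : Expr → ℕ
  | .lit c => c
  | .reg i => s.reg i
  | .load a => s.mem (a.eval s)
  | .plus a b => a.eval s + b.eval s
  | .minus a b => a.eval s - b.eval s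

/-- Overwrite a register. -/
def Store.setReg (s : Store) (i v : ℕ) : Store := { s with reg := Function.update s.reg i v }

/-- Overwrite a memory cell. -/
def Store.setMem (s : Store) (a v : ℕ) : Store := { s with mem := Function.update s.mem a v }

/-- A configuration: the commands still to be executed, and the store. -/
abbrev Config := List Cmd × Store

/-- One step of the machine; `flip` sets a register to the outcome `0` or `1` of a fair coin.
A configuration with nothing left to execute has halted. -/
noncomputable def step : Config → PMF Config
  | ([], s) => PMF.pure ([], s)
  | (.assign i a :: K, s) => PMF.pure (K, s.setReg i (a.eval s))
  | (.store a b :: K, s) => PMF.pure (K, s.setMem (a.eval s) (b.eval s))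
  | (.flip i :: K, s) => (PMF.uniformOfFintype Bool).map fun b => (K, s.setReg i b.toNat)
  | (.seq c d :: K, s) => PMF.pure (c :: d :: K, s)
  | (.ite a b c d :: K, s) =>
      PMF.pure (if a.eval s < b.eval s then (c :: K, s) else (d :: K, s))
  | (.while a b c :: K, s) =>
      PMF.pure (if a.eval s < b.eval s then (c :: .while a b c :: K, s) else (K, s))

/-- The distribution of the configuration after `t` steps of the program `M` from the store `s`. -/
noncomputable def run (M : Cmd) (s : Store) : ℕ → PMF Config
  | 0 => PMF.pure ([M], s)
  | t + 1 => (run M s t).bind step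

/-- The expected number `𝔼 T = ∑ₜ ℙ(T > t)` of steps before halting (infinite if the program runs
forever with positive probability). -/
noncomputable def expectedTime (M : Cmd) (s : Store) : ℝ≥0∞ :=
  ∑' t : ℕ, (run M s t).toOuterMeasure {c | c.1 ≠ []}

/-- The store `s` is a possible final store of the program `M` started in `s₀`. -/
def CanHaltIn (M : Cmd) (s₀ s : Store) : Prop :=
  ∃ t, ([], s) ∈ (run M s₀ t).support

/-- The initial store on the input word `w`: it is written in the memory from address `0` on, and
everything else is `0`. -/
def initial (w : List ℕ) : Store where
  reg _ := 0
  mem a := w.getD a 0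

end RAM

/-! ### Instances as inputs and outputs of the machine -/

/-- The list `L` presents the hyperedge set `E`: every hyperedge occurs exactly once, as a list of
its vertices, each listed once; both orders are arbitrary. -/
def Presents {n : ℕ} (L : List (List (Fin n))) (E : Finset (Finset (Fin n))) : Prop :=
  (∀ l ∈ L, l.Nodup) ∧ (L.map List.toFinset).Nodup ∧ (L.map List.toFinset).toFinset = E

/-- The input word: the six parameters (with the number of hyperedges second), followed by the
vertices of the hyperedges, one hyperedge after the other. -/
def inputWord {n : ℕ} (L : List (List (Fin n))) (k r p x : ℕ) : List ℕ :=
  [n, L.length, k, r, p, x] ++ L.flatten.map Fin.val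

/-- The final store `s` holds, from the address in register `0` on, the colors of the vertices
`0, …, n - 1` in the first coloring, then in the second one, and so on, and the `x` colorings `X`
written there form a strong `(r,p)` cover. -/
def OutputsStrongCover {n : ℕ} (E : Finset (Finset (Fin n))) (r p x : ℕ) (s : RAM.Store) : Prop :=
  ∃ X : Fin x → Fin n → Fin r,
    (∀ i v, s.mem (s.reg 0 + (i.val * n + v.val)) = (X i v).val) ∧
    IsStrongCover E p (Set.range X)

/-! The bad event of a hyperedge `e` is that each of the `x` colorings uses at most `p - 1` colors
on `e`. All these colors then lie in one of the `C(r,p-1)` sets of `p - 1` colors, so the event has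
probability at most `P = (C(r,p-1) (p-1)^k / r^k)^x`. The hypothesis says exactly `e P (d+1) ≤ 1`:
the symmetric local lemma condition.

The resampling bound avoids witness trees built from the run. A potential on families of colorings
counts stable set sequences instead. Such a sequence starts with a root `{f}`, and each later layer
is a set of pairwise disjoint hyperedges that all meet the layer before. Its weight at `X` is the
probability that a check succeeds which runs from the last layer back to the root, demanding that
the hyperedges of a layer are bad and then giving them fresh colors. One such check is the operator
`testAll`, and `potential` sums the weights.

Drift: if `e` is bad at `X`, resampling `e` is the same as prepending the check of `e`. Checks of
disjoint hyperedges commute, so the check of `e` slides past all layers disjoint from `e` until it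
reaches one that meets `e`, and it is inserted into the layer just after that one. This is
injective, and for the root `e` it misses the bare root, which has weight 1 at `X`. Hence `1 + 𝔼
Φ(next) ≤ Φ(X)` (`testAll_below_le`, `one_add_refresh_potential_le`). As `Φ` depends on the current
family only, the history and the selection rule play no role.

Mean: under uniform colors a layer `J` contributes at most `P ^ |J|`, by independence. If `P
(1+z)^(d+1) ≤ z`, the sum over layers telescopes to `𝔼 Φ ≤ |E| z` (`mean_potential_le`). With `z =
eP ≤ 1` the expected number of rounds is at most `|E|`. A cover must therefore exist, as otherwise
the algorithm would never stop.

For the machine, `ert` is an expected cost transformer. It is itself a potential for the chain of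
machine steps, so it bounds the expected time; charging `⊤` for wrong final stores turns finite
expected cost into correctness. Colors are drawn by rejection from random bits, and `Φ` pays for the
iterations of the main loop. -/

namespace MTC

/-! ### Averages over families of colorings -/

section Averages

variable {V : Type*} [DecidableEq V] {r x : ℕ}

/-- Replace the colors of the cells in `B` by those of `Y`. -/
def mix (B : Finset (Fin x × V)) (Y X : Fin x → V → Fin r) : Fin x → V → Fin r :=
  fun i v => if (i, v) ∈ B then Y i v else X i v

theorem mix_swap (B : Finset (Fin x × V)) (X Y : Fin x → V → Fin r) :
    mix B (mix B X Y) (mix B Y X) = X := by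
  funext i v
  simp only [mix]
  split_ifs <;> rfl

theorem mix_mix (B B' : Finset (Fin x × V)) (X Y Z : Fin x → V → Fin r) :
    mix B' Z (mix B Y X) = mix (B ∪ B') (mix B' Z Y) X := by
  funext i v
  simp only [mix, Finset.mem_union]
  split_ifs <;> simp_all

theorem mix_empty (Y X : Fin x → V → Fin r) : mix ∅ Y X = X := by
  funext i v
  simp [mix]

variable [Fintype V]

theorem mix_univ (Y X : Fin x → V → Fin r) : mix Finset.univ Y X = Y := by
  funext i v
  simp [mix]

/-- Exchanging the cells of `B` between two families is an involution on pairs. All independence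
used below comes from this invariance of the uniform distribution. -/
theorem sum_mix_swap {M : Type*} [AddCommMonoid M] (B : Finset (Fin x × V))
    (F : (Fin x → V → Fin r) → (Fin x → V → Fin r) → M) :
    ∑ X, ∑ Y, F (mix B Y X) (mix B X Y) = ∑ X, ∑ Y, F X Y := by
  rw [← Fintype.sum_prod_type', ← Fintype.sum_prod_type']
  exact Fintype.sum_equiv
    (Function.Involutive.toPerm
      (fun q : (Fin x → V → Fin r) × (Fin x → V → Fin r) => (mix B q.2 q.1, mix B q.1 q.2))
      (fun q => by simp only [mix_swap]))
    _ _ fun q => rfl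

/-- The average over all families of colorings. -/
noncomputable def mean (g : (Fin x → V → Fin r) → ℝ≥0∞) : ℝ≥0∞ :=
  (Fintype.card (Fin x → V → Fin r) : ℝ≥0∞)⁻¹ * ∑ X, g X

theorem mean_const [NeZero r] (c : ℝ≥0∞) :
    mean (fun _ : Fin x → V → Fin r => c) = c := by
  rw [mean, Finset.sum_const, nsmul_eq_mul, Finset.card_univ, ← mul_assoc,
    ENNReal.inv_mul_cancel, one_mul]
  · exact_mod_cast Fintype.card_ne_zero
  · exact ENNReal.natCast_ne_top _

theorem mean_mono {g h : (Fin x → V → Fin r) → ℝ≥0∞} (H : ∀ X, g X ≤ h X) :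
    mean g ≤ mean h := by
  unfold mean
  gcongr with X
  exact H X

theorem mean_add (g h : (Fin x → V → Fin r) → ℝ≥0∞) :
    mean (fun X => g X + h X) = mean g + mean h := by
  simp only [mean, Finset.sum_add_distrib, mul_add]

theorem mean_sum {ι : Type*} (s : Finset ι) (g : ι → (Fin x → V → Fin r) → ℝ≥0∞) :
    mean (fun X => ∑ i ∈ s, g i X) = ∑ i ∈ s, mean (g i) := by
  simp only [mean, ← Finset.mul_sum]
  rw [Finset.sum_comm]

theorem mean_const_mul (c : ℝ≥0∞) (g : (Fin x → V → Fin r) → ℝ≥0∞) :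
    mean (fun X => c * g X) = c * mean g := by
  simp only [mean, ← Finset.mul_sum]
  ring

theorem mean_mul_const (c : ℝ≥0∞) (g : (Fin x → V → Fin r) → ℝ≥0∞) :
    mean (fun X => g X * c) = mean g * c := by
  simp only [mean, ← Finset.sum_mul]
  ring

theorem mean_iSup (g : ℕ → (Fin x → V → Fin r) → ℝ≥0∞) (hg : Monotone g) :
    mean (fun X => ⨆ N, g N X) = ⨆ N, mean (g N) := by
  simp only [mean]
  rw [ENNReal.finsetSum_iSup_of_monotone (fun X _ _ h => hg h X), ENNReal.mul_iSup]

theorem mean_mean_mix (B : Finset (Fin x × V))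
    (F : (Fin x → V → Fin r) → (Fin x → V → Fin r) → ℝ≥0∞) :
    mean (fun X => mean fun Y => F (mix B Y X) (mix B X Y)) =
      mean fun X => mean fun Y => F X Y := by
  simp only [mean, ← Finset.mul_sum]
  rw [sum_mix_swap]

/-- The average over new uniform colors of the cells in `B`. -/
noncomputable def refresh (B : Finset (Fin x × V)) (g : (Fin x → V → Fin r) → ℝ≥0∞)
    (X : Fin x → V → Fin r) : ℝ≥0∞ :=
  mean fun Y => g (mix B Y X)

/-- On the overlap of `B` and `B'` the second draw overwrites the first; a uniform family with some
cells replaced by those of another independent uniform family is still uniform. -/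
theorem refresh_refresh [NeZero r] (B B' : Finset (Fin x × V))
    (g : (Fin x → V → Fin r) → ℝ≥0∞) :
    refresh B (refresh B' g) = refresh (B ∪ B') g := by
  funext X
  simp only [refresh, mix_mix]
  rw [mean_mean_mix B' fun Y _ => g (mix (B ∪ B') Y X)]
  simp only [mean_const]

theorem refresh_empty [NeZero r] (g : (Fin x → V → Fin r) → ℝ≥0∞) : refresh ∅ g = g := by
  funext X
  simp only [refresh, mix_empty, mean_const]

theorem refresh_univ (g : (Fin x → V → Fin r) → ℝ≥0∞) (X : Fin x → V → Fin r) :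
    refresh Finset.univ g X = mean g := by
  simp only [refresh, mix_univ]

theorem refresh_mono (B : Finset (Fin x × V)) {g h : (Fin x → V → Fin r) → ℝ≥0∞}
    (H : ∀ X, g X ≤ h X) (X : Fin x → V → Fin r) : refresh B g X ≤ refresh B h X :=
  mean_mono fun _ => H _

theorem refresh_const_add [NeZero r] (B : Finset (Fin x × V)) (c : ℝ≥0∞)
    (g : (Fin x → V → Fin r) → ℝ≥0∞) (X : Fin x → V → Fin r) :
    refresh B (fun Y => c + g Y) X = c + refresh B g X := by
  simp only [refresh]
  rw [mean_add (fun _ => c), mean_const]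

theorem refresh_const_mul (B : Finset (Fin x × V)) (c : ℝ≥0∞)
    (g : (Fin x → V → Fin r) → ℝ≥0∞) (X : Fin x → V → Fin r) :
    refresh B (fun Y => c * g Y) X = c * refresh B g X :=
  mean_const_mul c _

/-- Independence: by `ha`, the function `a` looks only at the cells in `B`, whereas `refresh B g`
ignores them. -/
theorem mean_mul_refresh (B : Finset (Fin x × V)) (a g : (Fin x → V → Fin r) → ℝ≥0∞)
    (ha : ∀ X Y, a (mix B X Y) = a X) :
    mean (fun X => a X * refresh B g X) = mean a * mean g := by
  simp only [refresh, ← mean_const_mul]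
  have h := mean_mean_mix B fun X Y => a Y * g X
  simp only [ha] at h
  rw [h]
  simp only [mean_mul_const, mean_const_mul]

end Averages

/-! ### Bad events and stable set sequences -/

section Events

variable {V : Type*} {r x : ℕ}

/-- All colors of the vertices in `e`. -/
def cells (x : ℕ) (e : Finset V) : Finset (Fin x × V) := Finset.univ ×ˢ e

theorem mem_cells {e : Finset V} {i : Fin x} {v : V} : (i, v) ∈ cells x e ↔ v ∈ e := by
  simp [cells]

/-- No coloring of the family colors `e` properly. -/
def Bad (p : ℕ) (X : Fin x → V → Fin r) (e : Finset V) : Prop :=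
  ∀ i, ¬ ProperlyColored p (X i) e

theorem bad_congr {p : ℕ} {X Y : Fin x → V → Fin r} {e : Finset V}
    (h : ∀ i, ∀ v ∈ e, X i v = Y i v) : Bad p X e ↔ Bad p Y e := by
  have : ∀ i, e.image (X i) = e.image (Y i) := fun i => Finset.image_congr (h i)
  simp only [Bad, ProperlyColored, this]

variable [DecidableEq V]

theorem bad_mix_self {p : ℕ} (X Y : Fin x → V → Fin r) (e : Finset V) :
    Bad p (mix (cells x e) X Y) e ↔ Bad p X e :=
  bad_congr fun i v hv => by simp [mix, mem_cells, hv]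

theorem bad_mix_of_disjoint {p : ℕ} (X Y : Fin x → V → Fin r) {e f : Finset V}
    (h : Disjoint e f) : Bad p (mix (cells x e) X Y) f ↔ Bad p Y f :=
  bad_congr fun i v hv => by
    simp [mix, mem_cells, Finset.disjoint_right.1 h hv]

variable [Fintype V]

open Classical in
/-- Test the bad events of `J` and refresh their vertices. -/
noncomputable def testAll (p : ℕ) (J : Finset (Finset V)) (g : (Fin x → V → Fin r) → ℝ≥0∞)
    (X : Fin x → V → Fin r) : ℝ≥0∞ :=
  if ∀ f ∈ J, Bad p X f then refresh (cells x (J.sup id)) g X else 0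

theorem testAll_mono (p : ℕ) (J : Finset (Finset V)) {g h : (Fin x → V → Fin r) → ℝ≥0∞}
    (H : g ≤ h) : testAll p J g ≤ testAll p J h := by
  intro X
  unfold testAll
  split_ifs
  · exact refresh_mono _ H X
  · exact le_rfl

theorem testAll_empty [NeZero r] (p : ℕ) (g : (Fin x → V → Fin r) → ℝ≥0∞) :
    testAll p ∅ g = g := by
  funext X
  have : cells x (∅ : Finset V) = ∅ := by simp [cells]
  simp [testAll, this, refresh_empty]

theorem testAll_zero (p : ℕ) (J : Finset (Finset V)) :
    testAll p J (0 : (Fin x → V → Fin r) → ℝ≥0∞) = 0 := by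
  funext X
  simp [testAll, refresh, mean]

theorem testAll_add (p : ℕ) (J : Finset (Finset V)) (g h : (Fin x → V → Fin r) → ℝ≥0∞) :
    testAll p J (g + h) = testAll p J g + testAll p J h := by
  funext X
  simp only [testAll, Pi.add_apply]
  split_ifs
  · exact mean_add _ _
  · simp

theorem testAll_sum (p : ℕ) (J : Finset (Finset V)) {ι : Type*} (s : Finset ι)
    (g : ι → (Fin x → V → Fin r) → ℝ≥0∞) :
    testAll p J (∑ i ∈ s, g i) = ∑ i ∈ s, testAll p J (g i) := by
  classical
  induction s using Finset.induction_on with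
  | empty => exact testAll_zero p J
  | insert a s ha ih => rw [Finset.sum_insert ha, Finset.sum_insert ha, testAll_add, ih]

/-- Fresh colors on the hyperedges of `J` do not touch those of `K`, so both tests can be made
before any refreshing. The right side is symmetric, whence disjoint checks commute. -/
theorem testAll_testAll [NeZero r] (p : ℕ) {J K : Finset (Finset V)}
    (h : Disjoint (J.sup id) (K.sup id)) (g : (Fin x → V → Fin r) → ℝ≥0∞) :
    testAll p J (testAll p K g) = testAll p (J ∪ K) g := by
  funext X
  have hK : ∀ Y, (∀ f ∈ K, Bad p (mix (cells x (J.sup id)) Y X) f) ↔ ∀ f ∈ K, Bad p X f :=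
    fun Y => forall₂_congr fun f hf =>
      bad_mix_of_disjoint Y X (h.mono_right (Finset.le_sup (f := id) hf))
  have hc : cells x ((J ∪ K).sup id) = cells x (J.sup id) ∪ cells x (K.sup id) := by
    rw [Finset.sup_union]
    exact Finset.product_union
  have hJ : (∀ f ∈ J ∪ K, Bad p X f) ↔ (∀ f ∈ J, Bad p X f) ∧ ∀ f ∈ K, Bad p X f :=
    Finset.forall_mem_union
  rw [testAll, testAll, hc, ← refresh_refresh]
  by_cases h1 : ∀ f ∈ J, Bad p X f
  · by_cases h2 : ∀ f ∈ K, Bad p X f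
    · rw [if_pos h1, if_pos (hJ.2 ⟨h1, h2⟩)]
      exact congrArg mean (funext fun Y => if_pos ((hK Y).2 h2))
    · rw [if_pos h1, if_neg fun h => h2 (hJ.1 h).2]
      have hz : ∀ Y, testAll p K g (mix (cells x (J.sup id)) Y X) = 0 :=
        fun Y => if_neg fun h => h2 ((hK Y).1 h)
      simp [refresh, mean, hz]
  · rw [if_neg h1, if_neg fun h => h1 (hJ.1 h).1]

theorem testAll_comm [NeZero r] (p : ℕ) {J K : Finset (Finset V)}
    (h : Disjoint (J.sup id) (K.sup id)) (g : (Fin x → V → Fin r) → ℝ≥0∞) :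
    testAll p J (testAll p K g) = testAll p K (testAll p J g) := by
  rw [testAll_testAll p h, testAll_testAll p h.symm, Finset.union_comm]

theorem testAll_singleton (p : ℕ) (e : Finset V) (g : (Fin x → V → Fin r) → ℝ≥0∞)
    {X : Fin x → V → Fin r} (h : Bad p X e) :
    testAll p {e} g X = refresh (cells x e) g X := by
  simp [testAll, h]

/-- Peel off one hyperedge at a time: its bad event depends only on its own cells, and these are
fresh afterwards, so its probability factors out. -/
theorem mean_testAll_le [NeZero r] {p : ℕ} {P : ℝ≥0∞} {J : Finset (Finset V)}
    (hP : ∀ e ∈ J, mean (testAll p {e} fun _ : Fin x → V → Fin r => 1) ≤ P)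
    (hJ : (J : Set (Finset V)).PairwiseDisjoint id) (g : (Fin x → V → Fin r) → ℝ≥0∞) :
    mean (testAll p J g) ≤ P ^ J.card * mean g := by
  classical
  induction J using Finset.induction_on generalizing g with
  | empty => simp [testAll_empty]
  | insert e J he ih =>
    have hd : Disjoint (({e} : Finset (Finset V)).sup id) (J.sup id) := by
      rw [Finset.sup_singleton, Finset.disjoint_sup_right]
      intro f hf
      exact hJ (by simp) (by simp [hf]) (fun h => he (h ▸ hf))
    have h1 := ih (fun f hf => hP f (Finset.mem_insert_of_mem hf))
      (hJ.subset (by simp)) g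
    rw [Finset.insert_eq, ← testAll_testAll p hd, ← Finset.insert_eq,
      Finset.card_insert_of_notMem he, pow_succ', mul_assoc]
    have h2 : ∀ h : (Fin x → V → Fin r) → ℝ≥0∞, mean (testAll p {e} h) =
        mean (testAll p {e} fun _ : Fin x → V → Fin r => 1) * mean h := by
      intro h
      have ha : ∀ X Y, testAll p {e} (fun _ : Fin x → V → Fin r => 1) (mix (cells x e) X Y) =
          testAll p {e} (fun _ : Fin x → V → Fin r => 1) X := by
        intro X Y
        simp [testAll, bad_mix_self, refresh]
      rw [← mean_mul_refresh (cells x e) _ h ha]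
      congr 1
      funext X
      by_cases hb : Bad p X e
      · simp [testAll, hb, refresh, mean_const]
      · simp [testAll, hb]
    rw [h2]
    gcongr
    exact hP e (by simp)

end Events

/-! ### Stable set sequences: prepending a check, and the resulting potential -/

section Sequences

variable {V : Type*} {r x : ℕ} [DecidableEq V]

/-- The sets of pairwise disjoint hyperedges each of which meets a hyperedge of `I`. -/
noncomputable def layers (E I : Finset (Finset V)) : Finset (Finset (Finset V)) :=
  open Classical in
  (E.filter fun f => ¬ Disjoint f (I.sup id)).powerset.filter fun J =>
    (J : Set (Finset V)).PairwiseDisjoint id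

theorem mem_layers {E I J : Finset (Finset V)} : J ∈ layers E I ↔
    (∀ f ∈ J, f ∈ E ∧ ¬ Disjoint f (I.sup id)) ∧ (J : Set (Finset V)).PairwiseDisjoint id := by
  simp [layers, Finset.subset_iff]

theorem layers_mono {E I I' : Finset (Finset V)} (h : I ⊆ I') : layers E I ⊆ layers E I' := by
  intro J hJ
  rw [mem_layers] at hJ ⊢
  exact ⟨fun f hf => ⟨(hJ.1 f hf).1, fun hd => (hJ.1 f hf).2
    (hd.mono_right (Finset.sup_mono h))⟩, hJ.2⟩

/-- Empty layers pad short sequences, so depth exactly `N` covers all depths up to `N` and the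
truncations increase with `N`. -/
theorem empty_mem_layers (E I : Finset (Finset V)) : ∅ ∈ layers E I := by
  simp [mem_layers]

theorem card_neighbors_le (E I : Finset (Finset V)) (hI : I ⊆ E) :
    (E.filter fun f => ¬ Disjoint f (I.sup id)).card ≤ I.card * (dependency E + 1) := by
  have hsub : (E.filter fun f => ¬ Disjoint f (I.sup id)) ⊆
      I.biUnion fun e => insert e (E.filter fun f => f ≠ e ∧ (e ∩ f).Nonempty) := by
    intro f hf
    simp only [Finset.mem_filter, Finset.disjoint_sup_right, not_forall] at hf
    obtain ⟨hfE, e, he, hd⟩ := hf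
    refine Finset.mem_biUnion.2 ⟨e, he, ?_⟩
    by_cases h : f = e
    · simp [h]
    · refine Finset.mem_insert_of_mem (Finset.mem_filter.2 ⟨hfE, h, ?_⟩)
      rw [Finset.inter_comm]
      exact Finset.not_disjoint_iff_nonempty_inter.1 hd
  refine (Finset.card_le_card hsub).trans (Finset.card_biUnion_le_card_mul _ _ _ fun e he => ?_)
  refine (Finset.card_insert_le _ _).trans (Nat.add_le_add_right ?_ 1)
  exact Finset.le_sup (f := edgeDependency E) (hI he)

variable [Fintype V]

/-- The sum of `testAll p J_N ∘ ⋯ ∘ testAll p J_1` over all sequences `J_1, …, J_N` in which each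
set is a layer below the previous one, and `J_1` is a layer below `I`. -/
noncomputable def below (E : Finset (Finset V)) (p : ℕ) : ℕ → Finset (Finset V) →
    ((Fin x → V → Fin r) → ℝ≥0∞) → (Fin x → V → Fin r) → ℝ≥0∞
  | 0, _, g => g
  | N + 1, I, g => ∑ J ∈ layers E I, below E p N J (testAll p J g)

/-- The part of `below` where no layer meets `e`. -/
noncomputable def belowFar (E : Finset (Finset V)) (p : ℕ) (e : Finset V) : ℕ →
    Finset (Finset V) → ((Fin x → V → Fin r) → ℝ≥0∞) → (Fin x → V → Fin r) → ℝ≥0∞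
  | 0, _, g => g
  | N + 1, I, g => ∑ J ∈ layers E I with Disjoint e (J.sup id),
      belowFar E p e N J (testAll p J g)

/-- The part of `below` where some layer meets `e`. -/
noncomputable def belowNear (E : Finset (Finset V)) (p : ℕ) (e : Finset V) : ℕ →
    Finset (Finset V) → ((Fin x → V → Fin r) → ℝ≥0∞) → (Fin x → V → Fin r) → ℝ≥0∞
  | 0, _, _ => 0
  | N + 1, I, g => ∑ J ∈ layers E I with Disjoint e (J.sup id),
      belowNear E p e N J (testAll p J g) +
      ∑ J ∈ layers E I with ¬ Disjoint e (J.sup id), below E p N J (testAll p J g)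

theorem belowNear_add_belowFar (E : Finset (Finset V)) (p : ℕ) (e : Finset V) (N : ℕ)
    (I : Finset (Finset V)) (g : (Fin x → V → Fin r) → ℝ≥0∞) :
    belowNear E p e N I g + belowFar E p e N I g = below E p N I g := by
  induction N generalizing I g with
  | zero => exact zero_add _
  | succ N ih =>
    simp only [belowNear, belowFar, below]
    rw [add_right_comm, ← Finset.sum_add_distrib, ← Finset.sum_filter_add_sum_filter_not
      (layers E I) fun J => Disjoint e (J.sup id)]
    simp only [ih]

theorem belowNear_le_below (E : Finset (Finset V)) (p : ℕ) (e : Finset V) (N : ℕ)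
    (I : Finset (Finset V)) (g : (Fin x → V → Fin r) → ℝ≥0∞) :
    belowNear E p e N I g ≤ below E p N I g := by
  rw [← belowNear_add_belowFar E p e]
  exact le_self_add

theorem belowFar_mono (E : Finset (Finset V)) (p : ℕ) (e : Finset V) (N : ℕ)
    {I I' : Finset (Finset V)} (hI : I ⊆ I') {g h : (Fin x → V → Fin r) → ℝ≥0∞} (hg : g ≤ h) :
    belowFar E p e N I g ≤ belowFar E p e N I' h := by
  induction N generalizing I I' g h with
  | zero => exact hg
  | succ N ih =>
    refine (Finset.sum_le_sum fun J _ => ih (Finset.Subset.refl J) (testAll_mono p J hg)).trans ?_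
    exact Finset.sum_le_sum_of_subset (Finset.filter_subset_filter _ (layers_mono hI))

theorem belowFar_le_succ [NeZero r] (E : Finset (Finset V)) (p : ℕ) (e : Finset V) (N : ℕ)
    (I : Finset (Finset V)) (g : (Fin x → V → Fin r) → ℝ≥0∞) :
    belowFar E p e N I g ≤ belowFar E p e (N + 1) I g := by
  induction N generalizing I g with
  | zero =>
    have h : (∅ : Finset (Finset V)) ∈ {J ∈ layers E I | Disjoint e (J.sup id)} := by
      simp [empty_mem_layers]
    refine le_trans ?_ (Finset.single_le_sum (fun _ _ => zero_le) h)
    simp [belowFar, testAll_empty]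
  | succ N ih => exact Finset.sum_le_sum fun J _ => ih J _

theorem below_le_succ [NeZero r] (E : Finset (Finset V)) (p : ℕ) (N : ℕ)
    (I : Finset (Finset V)) (g : (Fin x → V → Fin r) → ℝ≥0∞) :
    below E p N I g ≤ below E p (N + 1) I g := by
  induction N generalizing I g with
  | zero =>
    refine le_trans ?_ (Finset.single_le_sum (fun _ _ => zero_le) (empty_mem_layers E I))
    simp [below, testAll_empty]
  | succ N ih => exact Finset.sum_le_sum fun J _ => ih J _

theorem le_belowFar [NeZero r] (E : Finset (Finset V)) (p : ℕ) (e : Finset V) (N : ℕ)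
    (I : Finset (Finset V)) (g : (Fin x → V → Fin r) → ℝ≥0∞) : g ≤ belowFar E p e N I g := by
  induction N with
  | zero => exact le_rfl
  | succ N ih => exact ih.trans (belowFar_le_succ E p e N I g)

/-- All layers involved are disjoint from `e`, so the check of `e` commutes with each of them and
reaches the root end. -/
theorem testAll_belowFar [NeZero r] (E : Finset (Finset V)) (p : ℕ) (e : Finset V) (N : ℕ)
    (I : Finset (Finset V)) (g : (Fin x → V → Fin r) → ℝ≥0∞) :
    testAll p {e} (belowFar E p e N I g) = belowFar E p e N I (testAll p {e} g) := by
  induction N generalizing I g with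
  | zero => rfl
  | succ N ih =>
    simp only [belowFar]
    rw [testAll_sum]
    refine Finset.sum_congr rfl fun J hJ => ?_
    rw [ih, testAll_comm]
    simpa using (Finset.mem_filter.1 hJ).2

/-- The insertion argument. The check of `e` joins the layer after the last one that meets `e`; this
may lengthen the sequence by one. If only `I` meets `e`, it joins the first layer. The outcome
always has a layer meeting `e`, hence `belowNear` on the right. Both claims are proved together, as
each step of the first uses the second one layer down. -/
theorem testAll_below_le [NeZero r] {E : Finset (Finset V)} (p : ℕ) {e : Finset V} (he : e ∈ E)
    (hne : e.Nonempty) (N : ℕ) (I : Finset (Finset V)) (g : (Fin x → V → Fin r) → ℝ≥0∞) :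
    testAll p {e} (belowNear E p e N I g) ≤ belowNear E p e (N + 1) I g ∧
      (¬ Disjoint e (I.sup id) →
        testAll p {e} (below E p N I g) ≤ belowNear E p e (N + 1) I g) := by
  have hee : ¬ Disjoint e e := fun h => hne.ne_empty (disjoint_self.1 h)
  induction N generalizing I g with
  | zero =>
    constructor
    · simp only [belowNear]
      rw [testAll_zero]
      exact fun _ => zero_le
    · intro hI
      have h : {e} ∈ {J ∈ layers E I | ¬ Disjoint e (J.sup id)} := by
        simp only [Finset.mem_filter, mem_layers]
        simp [he, hI, hne.ne_empty]
      exact (Finset.single_le_sum (f := fun J => testAll p J g) (fun _ _ => zero_le) h).trans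
        le_add_self
  | succ N ih =>
    have hnear : testAll p {e} (belowNear E p e (N + 1) I g) ≤
        ∑ J ∈ layers E I with Disjoint e (J.sup id),
          belowNear E p e (N + 1) J (testAll p J g) +
        ∑ J ∈ layers E I with ¬ Disjoint e (J.sup id),
          belowNear E p e (N + 1) J (testAll p J g) := by
      rw [belowNear, testAll_add, testAll_sum, testAll_sum]
      exact add_le_add (Finset.sum_le_sum fun J _ => (ih J _).1)
        (Finset.sum_le_sum fun J hJ => (ih J _).2 (Finset.mem_filter.1 hJ).2)
    refine ⟨hnear.trans ?_, fun hI => ?_⟩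
    · rw [belowNear]
      exact add_le_add le_rfl (Finset.sum_le_sum fun J _ => belowNear_le_below _ _ _ _ _ _)
    -- No layer meets `e`, but `I` does: `e` is added to the first layer `J`. The sequences obtained
    -- have a first layer meeting `e` and none after it that does, so they are exactly the part that
    -- `hnear` leaves free.
    · have hfar : testAll p {e} (belowFar E p e (N + 1) I g) ≤
          ∑ J ∈ layers E I with ¬ Disjoint e (J.sup id),
            belowFar E p e (N + 1) J (testAll p J g) := by
        rw [testAll_belowFar, belowFar]
        have hnot : ∀ J ∈ {J ∈ layers E I | Disjoint e (J.sup id)}, e ∉ J := fun J hJ h =>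
          hee ((Finset.mem_filter.1 hJ).2.mono_right (Finset.le_sup (f := id) h))
        have hinj : Set.InjOn (insert e)
            ({J ∈ layers E I | Disjoint e (J.sup id)} : Set (Finset (Finset V))) := by
          intro J hJ K hK h
          have hJ' := hnot J (by simpa using hJ)
          have hK' := hnot K (by simpa using hK)
          rw [← Finset.erase_insert hJ', ← Finset.erase_insert hK', h]
        calc _ ≤ ∑ J ∈ layers E I with Disjoint e (J.sup id),
              belowFar E p e (N + 1) (insert e J) (testAll p (insert e J) g) := by
              refine Finset.sum_le_sum fun J hJ => ?_
              have hd : Disjoint (J.sup id) (({e} : Finset (Finset V)).sup id) := by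
                simpa using (Finset.mem_filter.1 hJ).2.symm
              rw [testAll_testAll p hd, Finset.union_comm, ← Finset.insert_eq]
              exact (belowFar_le_succ _ _ _ _ _ _).trans
                (belowFar_mono _ _ _ _ (Finset.subset_insert e J) le_rfl)
          _ = ∑ J ∈ {J ∈ layers E I | Disjoint e (J.sup id)}.image (insert e),
              belowFar E p e (N + 1) J (testAll p J g) :=
              (Finset.sum_image (f := fun J => belowFar E p e (N + 1) J (testAll p J g))
                (by simpa using hinj)).symm
          _ ≤ _ := by
              refine Finset.sum_le_sum_of_subset fun K hK => ?_
              obtain ⟨J, hJ, rfl⟩ := Finset.mem_image.1 hK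
              rw [Finset.mem_filter, mem_layers] at hJ ⊢
              obtain ⟨⟨h1, h2⟩, h3⟩ := hJ
              refine ⟨⟨?_, ?_⟩, ?_⟩
              · intro f hf
                rcases Finset.mem_insert.1 hf with rfl | hf
                · exact ⟨he, hI⟩
                · exact h1 f hf
              · rw [Finset.coe_insert]
                refine h2.insert fun f hf _ => ?_
                exact h3.mono_right (Finset.le_sup (f := id) hf)
              · rw [Finset.sup_insert]
                exact fun h => hee (h.mono_right le_sup_left)
      rw [← belowNear_add_belowFar E p e, testAll_add]
      refine (add_le_add hnear hfar).trans ?_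
      rw [add_assoc, ← Finset.sum_add_distrib]
      simp only [belowNear_add_belowFar]
      exact le_rfl

/-! ### The potential, its drift and its mean -/

/-- The potential of a family of colorings, truncated at depth `N`. -/
noncomputable def potentialUpTo (E : Finset (Finset V)) (p N : ℕ) (X : Fin x → V → Fin r) :
    ℝ≥0∞ :=
  ∑ f ∈ E, below E p N {f} (testAll p {f} 1) X

/-- An upper bound for the expected number of resampling rounds that start with the family `X`. -/
noncomputable def potential (E : Finset (Finset V)) (p : ℕ) (X : Fin x → V → Fin r) : ℝ≥0∞ :=
  ⨆ N, potentialUpTo E p N X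

theorem potentialUpTo_mono [NeZero r] (E : Finset (Finset V)) (p : ℕ) :
    Monotone fun N => potentialUpTo (x := x) (r := r) E p N :=
  monotone_nat_of_le_succ fun _ X => Finset.sum_le_sum fun _ _ => below_le_succ _ _ _ _ _ X

theorem one_add_refresh_potentialUpTo_le [NeZero r] {E : Finset (Finset V)} {p : ℕ} {e : Finset V}
    (he : e ∈ E) (hne : e.Nonempty) (N : ℕ) {X : Fin x → V → Fin r} (hX : Bad p X e) :
    1 + refresh (cells x e) (potentialUpTo E p N) X ≤ potentialUpTo E p (N + 1) X := by
  have h1 : refresh (cells x e) (potentialUpTo E p N) X =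
      ∑ f ∈ E, testAll p {e} (below E p N {f} (testAll p {f} 1)) X := by
    unfold refresh potentialUpTo
    rw [mean_sum]
    refine Finset.sum_congr rfl fun f _ => ?_
    rw [testAll_singleton p e _ hX]
    rfl
  have hgen : ∀ f, testAll p {e} (below E p N {f} (testAll p {f} 1)) X ≤
      below E p (N + 1) {f} (testAll p {f} 1) X := by
    intro f
    by_cases hd : Disjoint e (({f} : Finset (Finset V)).sup id)
    -- The root `f` is disjoint from `e`. Where some layer meets `e`, the check is inserted;
    -- otherwise it slides past everything and is dropped, as its weight is at most 1.
    · rw [← belowNear_add_belowFar E p e, ← belowNear_add_belowFar E p e, testAll_add]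
      refine add_le_add ((testAll_below_le p he hne N {f} _).1 X) ?_
      rw [testAll_belowFar, testAll_comm p (by simpa using hd)]
      refine (belowFar_mono E p e N (Finset.Subset.refl _) (testAll_mono p {f} ?_) X).trans
        (belowFar_le_succ E p e N _ _ X)
      intro Y
      simp only [testAll, Pi.one_apply]
      split_ifs
      · exact (mean_const (1 : ℝ≥0∞)).le
      · exact zero_le
    · exact ((testAll_below_le p he hne N {f} _).2 hd X).trans
        (belowNear_le_below _ _ _ _ _ _ X)
  -- The extra 1: insertion only produces sequences with a layer meeting `e`, so the bare root `e`,
  -- of weight 1 because `e` is bad at `X`, is still available.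
  have hself : 1 + testAll p {e} (below E p N {e} (testAll p {e} 1)) X ≤
      below E p (N + 1) {e} (testAll p {e} 1) X := by
    have hd : ¬ Disjoint e (({e} : Finset (Finset V)).sup id) := by
      simpa using hne.ne_empty
    rw [← belowNear_add_belowFar E p e (N + 1), add_comm]
    refine add_le_add ((testAll_below_le p he hne N {e} _).2 hd X) ?_
    refine le_trans ?_ (le_belowFar E p e (N + 1) {e} (testAll p {e} 1) X)
    rw [testAll_singleton p e _ hX]
    exact (mean_const (1 : ℝ≥0∞)).ge
  rw [h1, potentialUpTo, ← Finset.add_sum_erase _ _ he, ← Finset.add_sum_erase _ _ he, ← add_assoc]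
  exact add_le_add hself (Finset.sum_le_sum fun f _ => hgen f)

theorem one_add_refresh_potential_le [NeZero r] {E : Finset (Finset V)} {p : ℕ} {e : Finset V}
    (he : e ∈ E) (hne : e.Nonempty) {X : Fin x → V → Fin r} (hX : Bad p X e) :
    1 + refresh (cells x e) (potential E p) X ≤ potential E p X := by
  unfold refresh potential
  rw [mean_iSup (fun N Y => potentialUpTo E p N (mix (cells x e) Y X))
    (fun M N h Y => potentialUpTo_mono E p h _), ENNReal.add_iSup]
  exact iSup_le fun N => (one_add_refresh_potentialUpTo_le he hne N hX).trans
    (le_iSup (fun N => potentialUpTo E p N X) (N + 1))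

/-- By induction and independence, a first layer `J` together with everything below it costs at most
`z ^ |J|`. Summing over all sets of neighbors of `I`, disjoint or not, gives `(1+z)` to the number
of neighbors, which is at most `(d+1) |I|`. -/
theorem mean_below_le [NeZero r] {E : Finset (Finset V)} {p : ℕ} {P z : ℝ≥0∞}
    (hP : ∀ e ∈ E, mean (testAll p {e} fun _ : Fin x → V → Fin r => 1) ≤ P)
    (hz : P * (1 + z) ^ (dependency E + 1) ≤ z) (N : ℕ) {I : Finset (Finset V)} (hI : I ⊆ E)
    (g : (Fin x → V → Fin r) → ℝ≥0∞) :
    mean (below E p N I g) ≤ ((1 + z) ^ (dependency E + 1)) ^ I.card * mean g := by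
  induction N generalizing I g with
  | zero =>
    refine le_mul_of_one_le_left zero_le ?_
    exact one_le_pow₀ (one_le_pow₀ le_self_add)
  | succ N ih =>
    have hsum : mean (below E p (N + 1) I g) =
        ∑ J ∈ layers E I, mean (below E p N J (testAll p J g)) := by
      rw [← mean_sum]
      exact congrArg mean (funext fun X => Finset.sum_apply X _ _)
    rw [hsum]
    have hle : ∀ J ∈ layers E I, mean (below E p N J (testAll p J g)) ≤ z ^ J.card * mean g := by
      intro J hJ
      rw [mem_layers] at hJ
      have hJE : J ⊆ E := fun f hf => (hJ.1 f hf).1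
      refine (ih hJE _).trans ?_
      calc _ ≤ ((1 + z) ^ (dependency E + 1)) ^ J.card * (P ^ J.card * mean g) := by
            gcongr
            exact mean_testAll_le (fun e he => hP e (hJE he)) hJ.2 g
        _ = (P * (1 + z) ^ (dependency E + 1)) ^ J.card * mean g := by
            rw [mul_pow]; ring
        _ ≤ _ := by gcongr
    refine (Finset.sum_le_sum hle).trans ?_
    rw [← Finset.sum_mul]
    gcongr
    calc ∑ J ∈ layers E I, z ^ J.card
        ≤ ∑ J ∈ (E.filter fun f => ¬ Disjoint f (I.sup id)).powerset, z ^ J.card := by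
          classical exact Finset.sum_le_sum_of_subset (Finset.filter_subset _ _)
      _ = (1 + z) ^ (E.filter fun f => ¬ Disjoint f (I.sup id)).card := by
          have := (Finset.prod_add (fun _ => z) (fun _ => (1 : ℝ≥0∞))
            (E.filter fun f => ¬ Disjoint f (I.sup id))).symm
          simpa [add_comm] using this
      _ ≤ (1 + z) ^ ((dependency E + 1) * I.card) :=
          pow_le_pow_right₀ le_self_add (by rw [mul_comm]; exact card_neighbors_le E I hI)
      _ = _ := pow_mul _ _ _

theorem mean_potential_le [NeZero r] {E : Finset (Finset V)} {p : ℕ} {P z : ℝ≥0∞}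
    (hP : ∀ e ∈ E, mean (testAll p {e} fun _ : Fin x → V → Fin r => 1) ≤ P)
    (hz : P * (1 + z) ^ (dependency E + 1) ≤ z) :
    mean (potential (x := x) (r := r) E p) ≤ E.card * z := by
  unfold potential
  rw [mean_iSup _ (potentialUpTo_mono E p)]
  refine iSup_le fun N => ?_
  unfold potentialUpTo
  rw [mean_sum, ← nsmul_eq_mul]
  refine Finset.sum_le_card_nsmul _ _ _ fun f hf => ?_
  refine (mean_below_le hP hz N (Finset.singleton_subset_iff.2 hf) _).trans ?_
  refine le_trans ?_ hz
  rw [Finset.card_singleton, pow_one, mul_comm]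
  gcongr
  exact hP f hf

end Sequences

end MTC

/-! ### Potentials of Markov chains -/

namespace PMF

/-- The expected value of an extended nonnegative function. -/
noncomputable def expect {α : Type*} (q : PMF α) (g : α → ℝ≥0∞) : ℝ≥0∞ := ∑' a, q a * g a

theorem expect_pure {α : Type*} (a : α) (g : α → ℝ≥0∞) : (PMF.pure a).expect g = g a := by
  rw [expect, tsum_eq_single a]
  · simp
  · intro b hb
    simp [hb]

theorem expect_bind {α β : Type*} (q : PMF α) (f : α → PMF β) (g : β → ℝ≥0∞) :
    (q.bind f).expect g = q.expect fun a => (f a).expect g := by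
  simp only [expect, PMF.bind_apply, ← ENNReal.tsum_mul_right, ← ENNReal.tsum_mul_left]
  rw [ENNReal.tsum_comm]
  simp only [mul_assoc]

theorem expect_map {α β : Type*} (q : PMF α) (f : α → β) (g : β → ℝ≥0∞) :
    (q.map f).expect g = q.expect (g ∘ f) := by
  rw [PMF.map, expect_bind]
  simp only [Function.comp_apply, expect_pure]
  rfl

theorem expect_mono {α : Type*} (q : PMF α) {g h : α → ℝ≥0∞} (H : ∀ a, g a ≤ h a) :
    q.expect g ≤ q.expect h :=
  ENNReal.tsum_le_tsum fun a => by gcongr; exact H a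

theorem expect_add {α : Type*} (q : PMF α) (g h : α → ℝ≥0∞) :
    q.expect (fun a => g a + h a) = q.expect g + q.expect h := by
  simp only [expect, mul_add, ENNReal.tsum_add]

theorem expect_uniform {α : Type*} [Fintype α] [Nonempty α] (g : α → ℝ≥0∞) :
    (PMF.uniformOfFintype α).expect g = (Fintype.card α : ℝ≥0∞)⁻¹ * ∑ a, g a := by
  simp [expect, tsum_fintype, Finset.mul_sum]

theorem toOuterMeasure_eq_expect {α : Type*} (q : PMF α) (B : Set α) :
    q.toOuterMeasure B = q.expect (B.indicator 1) := by
  rw [PMF.toOuterMeasure_apply, expect]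
  congr 1
  funext a
  by_cases h : a ∈ B <;> simp [h]

/-- Each visit to `B` lowers the expected potential by at least one. The leftover term `(q N).expect
Φ` is kept, since the correctness of programs is read off from it. -/
theorem sum_toOuterMeasure_add_expect_le {α : Type*} {step : α → PMF α} {q : ℕ → PMF α}
    (hq : ∀ t, q (t + 1) = (q t).bind step) {B : Set α} {Φ : α → ℝ≥0∞}
    (hΦ : ∀ a, B.indicator 1 a + (step a).expect Φ ≤ Φ a) (N : ℕ) :
    ∑ t ∈ Finset.range N, (q t).toOuterMeasure B + (q N).expect Φ ≤ (q 0).expect Φ := by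
  induction N with
  | zero => simp
  | succ N ih =>
    refine le_trans ?_ ih
    rw [Finset.sum_range_succ, add_assoc, hq, expect_bind, toOuterMeasure_eq_expect (q N),
      ← expect_add]
    gcongr
    exact expect_mono _ hΦ

theorem tsum_toOuterMeasure_le {α : Type*} {step : α → PMF α} {q : ℕ → PMF α}
    (hq : ∀ t, q (t + 1) = (q t).bind step) {B : Set α} {Φ : α → ℝ≥0∞}
    (hΦ : ∀ a, B.indicator 1 a + (step a).expect Φ ≤ Φ a) :
    ∑' t, (q t).toOuterMeasure B ≤ (q 0).expect Φ := by
  rw [ENNReal.tsum_eq_iSup_nat]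
  exact iSup_le fun N => le_self_add.trans (sum_toOuterMeasure_add_expect_le hq hΦ N)

end PMF

namespace MTC

/-! ### The probability of a bad event -/

section Probability

variable {V : Type*} [DecidableEq V] {r x : ℕ}

-- Union bound over the sets `D` of `p - 1` colors that contain all colors on `e`; vertices outside
-- `e` are free. Multiplying by `r ^ k` avoids division.
open Classical in
theorem card_not_properlyColored_le [Fintype V] {k p : ℕ} {e : Finset V} (he : e.card = k)
    (hp : 1 ≤ p) (hpk : p ≤ k) (hpr : p ≤ r) :
    (Finset.univ.filter fun c : V → Fin r => ¬ ProperlyColored p c e).card * r ^ k ≤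
      (r.choose (p - 1) * (p - 1) ^ k) * r ^ Fintype.card V := by
  have hsub : (Finset.univ.filter fun c : V → Fin r => ¬ ProperlyColored p c e) ⊆
      ((Finset.univ : Finset (Fin r)).powersetCard (p - 1)).biUnion fun D =>
        Fintype.piFinset fun v => if v ∈ e then D else Finset.univ := by
    intro c hc
    have hc := (Finset.mem_filter.1 hc).2
    rw [ProperlyColored, he, min_eq_left hpk, not_le] at hc
    obtain ⟨D, hD1, hD2⟩ := Finset.exists_superset_card_eq (s := e.image c) (n := p - 1)
      (by omega) (by rw [Fintype.card_fin]; omega)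
    refine Finset.mem_biUnion.2 ⟨D, Finset.mem_powersetCard.2 ⟨Finset.subset_univ _, hD2⟩, ?_⟩
    refine Fintype.mem_piFinset.2 fun v => ?_
    split_ifs with hv
    · exact hD1 (Finset.mem_image_of_mem c hv)
    · exact Finset.mem_univ _
  have hcard : ∀ D ∈ (Finset.univ : Finset (Fin r)).powersetCard (p - 1),
      (Fintype.piFinset fun v => if v ∈ e then D else Finset.univ).card ≤
        (p - 1) ^ k * r ^ (Fintype.card V - k) := by
    intro D hD
    rw [Fintype.card_piFinset]
    have h1 : ∀ v, (if v ∈ e then D else Finset.univ).card = if v ∈ e then p - 1 else r := by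
      intro v
      split_ifs
      · exact (Finset.mem_powersetCard.1 hD).2
      · simp
    simp only [h1]
    rw [Finset.prod_ite, Finset.prod_const, Finset.prod_const, Finset.filter_mem_eq_inter,
      Finset.univ_inter, he, Finset.filter_not, Finset.filter_mem_eq_inter, Finset.univ_inter,
      ← Finset.compl_eq_univ_sdiff, Finset.card_compl, he]
  have hle := (Finset.card_le_card hsub).trans (Finset.card_biUnion_le_card_mul _ _ _ hcard)
  rw [Finset.card_powersetCard, Finset.card_univ, Fintype.card_fin] at hle
  have hkV : k ≤ Fintype.card V := he ▸ Finset.card_le_univ e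
  calc _ ≤ r.choose (p - 1) * ((p - 1) ^ k * r ^ (Fintype.card V - k)) * r ^ k := by gcongr
    _ = r.choose (p - 1) * (p - 1) ^ k * r ^ (Fintype.card V - k + k) := by rw [pow_add]; ring
    _ = _ := by rw [Nat.sub_add_cancel hkV]

theorem mean_testAll_singleton_le [Fintype V] [NeZero r] {k p : ℕ} {e : Finset V}
    (he : e.card = k) (hp : 1 ≤ p) (hpk : p ≤ k) (hpr : p ≤ r) :
    mean (testAll p {e} fun _ : Fin x → V → Fin r => 1) ≤
      ENNReal.ofReal ((((p : ℝ) - 1) ^ k * (r.choose (p - 1) : ℝ) / (r : ℝ) ^ k) ^ x) := by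
  classical
  set S := Finset.univ.filter fun c : V → Fin r => ¬ ProperlyColored p c e with hS
  have hr : 0 < r := Nat.pos_of_ne_zero (NeZero.ne r)
  -- The families on which `e` is bad form the product of `x` copies of `S`; this gives the exponent
  -- `x`.
  have hsum : ∑ X : Fin x → V → Fin r, testAll p {e} (fun _ => 1) X = ((S.card ^ x : ℕ) : ℝ≥0∞) := by
    have h1 : ∀ X : Fin x → V → Fin r, testAll p {e} (fun _ => 1) X =
        if X ∈ Fintype.piFinset (fun _ : Fin x => S) then 1 else 0 := by
      intro X
      simp [testAll, refresh, mean_const, Bad, Fintype.mem_piFinset, hS]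
    simp only [h1]
    rw [Finset.sum_ite_mem, Finset.univ_inter, Finset.sum_const, Fintype.card_piFinset]
    simp
  have hcard := card_not_properlyColored_le (r := r) he hp hpk hpr
  rw [← hS] at hcard
  rw [mean, hsum]
  have hle : ((Fintype.card (Fin x → V → Fin r) : ℕ) : ℝ)⁻¹ * ((S.card ^ x : ℕ) : ℝ) ≤
      (((p : ℝ) - 1) ^ k * (r.choose (p - 1) : ℝ) / (r : ℝ) ^ k) ^ x := by
    have hr' : (0 : ℝ) < r := by exact_mod_cast hr
    have hcard' : (S.card : ℝ) * (r : ℝ) ^ k ≤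
        (r.choose (p - 1) * ((p : ℝ) - 1) ^ k) * (r : ℝ) ^ Fintype.card V := by
      have := (Nat.cast_le (α := ℝ)).2 hcard
      push_cast [Nat.cast_sub hp] at this
      exact this
    simp only [Fintype.card_fun, Fintype.card_fin]
    push_cast
    rw [← div_eq_inv_mul, ← div_pow]
    refine pow_le_pow_left₀ (by positivity) ?_ x
    rw [div_le_div_iff₀ (by positivity) (by positivity)]
    linarith
  calc _ = ENNReal.ofReal (((Fintype.card (Fin x → V → Fin r) : ℕ) : ℝ)⁻¹ *
        ((S.card ^ x : ℕ) : ℝ)) := by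
        rw [ENNReal.ofReal_mul (by positivity), ENNReal.ofReal_inv_of_pos
          (by exact_mod_cast Fintype.card_pos), ENNReal.ofReal_natCast, ENNReal.ofReal_natCast]
    _ ≤ _ := ENNReal.ofReal_le_ofReal hle

theorem mean_potential_le_card [Fintype V] [NeZero r] {E : Finset (Finset V)} {k p : ℕ}
    (h : DependencyCondition E k r p x) :
    mean (potential (x := x) (r := r) E p) ≤ E.card := by
  have hp := h.two_le_p
  have hr : (0 : ℝ) < r := by exact_mod_cast Nat.pos_of_ne_zero (NeZero.ne r)
  have hp' : (0 : ℝ) < (p : ℝ) - 1 := by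
    have : (2 : ℝ) ≤ p := by exact_mod_cast hp
    linarith
  have hc : (0 : ℝ) < (r.choose (p - 1) : ℝ) := by
    exact_mod_cast Nat.choose_pos ((Nat.sub_le p 1).trans h.p_le_r)
  set d := dependency E with hd
  set P : ℝ := (((p : ℝ) - 1) ^ k * (r.choose (p - 1) : ℝ) / (r : ℝ) ^ k) ^ x with hPdef
  have hP0 : 0 < P := by positivity
  have hPinv : ((r : ℝ) ^ k / (((p : ℝ) - 1) ^ k * (r.choose (p - 1) : ℝ))) ^ x = P⁻¹ := by
    rw [hPdef, ← inv_pow, inv_div]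
  have hdep := h.dependency_le
  rw [hPinv, ← hd] at hdep
  have hexp := Real.exp_pos 1
  have hkey : Real.exp 1 * P * ((d : ℝ) + 1) ≤ 1 := by
    have h1 : (d : ℝ) + 1 ≤ 1 / Real.exp 1 * P⁻¹ := by linarith
    calc Real.exp 1 * P * ((d : ℝ) + 1) ≤ Real.exp 1 * P * (1 / Real.exp 1 * P⁻¹) := by gcongr
      _ = 1 := by field_simp
  -- The choice `z = eP`: here `(1+z)^(d+1) ≤ exp(z(d+1)) ≤ e` by `hkey`.
  have hz : P * (1 + Real.exp 1 * P) ^ (d + 1) ≤ Real.exp 1 * P := by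
    rw [mul_comm (Real.exp 1)]
    gcongr
    calc (1 + P * Real.exp 1) ^ (d + 1) ≤ Real.exp (P * Real.exp 1) ^ (d + 1) := by
          gcongr
          rw [add_comm]
          exact Real.add_one_le_exp _
      _ = Real.exp (Real.exp 1 * P * ((d : ℝ) + 1)) := by
          rw [← Real.exp_nat_mul]
          push_cast
          ring_nf
      _ ≤ Real.exp 1 := Real.exp_le_exp.2 hkey
  have hz1 : Real.exp 1 * P ≤ 1 := by
    refine le_trans ?_ hkey
    exact le_mul_of_one_le_right (by positivity) (by linarith [Nat.cast_nonneg (α := ℝ) d])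
  have hz' : ENNReal.ofReal P * (1 + ENNReal.ofReal (Real.exp 1 * P)) ^ (dependency E + 1) ≤
      ENNReal.ofReal (Real.exp 1 * P) := by
    rw [← hd, ← ENNReal.ofReal_one, ← ENNReal.ofReal_add (by positivity) (by positivity),
      ← ENNReal.ofReal_pow (by positivity), ← ENNReal.ofReal_mul (by positivity)]
    exact ENNReal.ofReal_le_ofReal hz
  refine (mean_potential_le (P := ENNReal.ofReal P) (fun e he => ?_) hz').trans ?_
  · exact mean_testAll_singleton_le (h.uniform e he) (by omega) h.p_le_k h.p_le_r
  · refine mul_le_of_le_one_right zero_le ?_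
    rw [← ENNReal.ofReal_one]
    exact ENNReal.ofReal_le_ofReal hz1

end Probability

/-! ### The expected number of rounds -/

section Rounds

variable {V : Type*} {r x : ℕ}

theorem mem_violated {E : Finset (Finset V)} {p : ℕ} {X : Fin x → V → Fin r} {e : Finset V} :
    e ∈ violated E p X ↔ e ∈ E ∧ Bad p X e := by
  simp [violated, Bad]

theorem isStrongCover_iff {E : Finset (Finset V)} {p : ℕ} {X : Fin x → V → Fin r} :
    IsStrongCover E p (Set.range X) ↔ ∀ e ∈ E, ¬ Bad p X e := by
  simp [IsStrongCover, Bad]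

theorem not_isStrongCover_iff {E : Finset (Finset V)} {p : ℕ} {X : Fin x → V → Fin r} :
    ¬ IsStrongCover E p (Set.range X) ↔ (violated E p X).Nonempty := by
  rw [isStrongCover_iff]
  simp [Finset.Nonempty, mem_violated]

variable [Fintype V] [DecidableEq V]

theorem expect_resample [NeZero r] (e : Finset V) (X : Fin x → V → Fin r)
    (g : (Fin x → V → Fin r) → ℝ≥0∞) :
    (resample e X).expect g = refresh (cells x e) g X := by
  rw [resample, PMF.expect_map, PMF.expect_uniform]
  have h : ∀ Y, mix (cells x e) Y X = fun i v => if v ∈ e then Y i v else X i v := by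
    intro Y
    funext i v
    simp [mix, mem_cells]
  simp only [refresh, mean, h]
  rfl

theorem expectedRounds_le [NeZero r] {E : Finset (Finset V)} {k p : ℕ}
    {pick : List (Fin x → V → Fin r) → (Fin x → V → Fin r) → Finset V}
    (h : DependencyCondition E k r p x) (hpick : IsSelectionRule E p pick) :
    expectedRounds E p pick ≤ E.card := by
  have hstep : ∀ S : List (Fin x → V → Fin r) × (Fin x → V → Fin r),
      {S | ¬ IsStrongCover E p (Set.range S.2)}.indicator 1 S +
        (round E p pick S).expect (fun S => potential E p S.2) ≤ potential E p S.2 := by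
    intro S
    by_cases hv : (violated E p S.2).Nonempty
    · have hm := mem_violated.1 (hpick S.1 S.2 hv)
      have hne : (pick S.1 S.2).Nonempty := by
        rw [← Finset.card_pos, h.uniform _ hm.1]
        exact (zero_lt_two.trans_le h.two_le_p).trans_le h.p_le_k
      rw [round, if_pos hv, PMF.expect_map, expect_resample, Set.indicator_of_mem]
      · exact one_add_refresh_potential_le hm.1 hne hm.2
      · exact not_isStrongCover_iff.2 hv
    · rw [round, if_neg hv, PMF.expect_pure, Set.indicator_of_notMem, zero_add]
      exact fun hn => hv (not_isStrongCover_iff.1 hn)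
  refine (PMF.tsum_toOuterMeasure_le (q := state E p pick) (fun t => rfl) hstep).trans ?_
  rw [state, PMF.expect_map, PMF.expect_uniform]
  exact mean_potential_le_card h

/-- Without a cover every family would have a violated hyperedge, so the algorithm would run
forever, against the finite bound on its expected number of rounds. -/
theorem exists_isStrongCover [NeZero r] {E : Finset (Finset V)} {k p : ℕ}
    (h : DependencyCondition E k r p x) :
    ∃ X : Fin x → V → Fin r, IsStrongCover E p (Set.range X) := by
  classical
  by_contra hno
  push Not at hno
  have hv : ∀ X : Fin x → V → Fin r, (violated E p X).Nonempty :=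
    fun X => not_isStrongCover_iff.1 (hno X)
  have hle := expectedRounds_le (pick := fun _ X => (hv X).choose) h
    fun _ X _ => (hv X).choose_spec
  have htop : expectedRounds E p (fun _ X => (hv X).choose) = ⊤ := by
    have h1 : {S : List (Fin x → V → Fin r) × (Fin x → V → Fin r) |
        ¬ IsStrongCover E p (Set.range S.2)} = Set.univ :=
      Set.eq_univ_of_forall fun S => hno S.2
    rw [expectedRounds, h1]
    have h2 : ∀ t, (state E p (fun _ X => (hv X).choose) t).toOuterMeasure Set.univ = 1 :=
      fun t => (PMF.toOuterMeasure_apply_eq_one_iff _ _).2 (Set.subset_univ _)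
    simp only [h2]
    exact ENNReal.tsum_const_eq_top_of_ne_zero one_ne_zero
  rw [htop, top_le_iff] at hle
  exact ENNReal.natCast_ne_top _ hle

theorem strongCoverNumber_le {E : Finset (Finset V)} {k p : ℕ}
    (h : DependencyCondition E k r p x) : strongCoverNumber E r p ≤ (x : ℕ∞) := by
  have : NeZero r := ⟨by have := h.two_le_p; have := h.p_le_r; omega⟩
  obtain ⟨X, hX⟩ := exists_isStrongCover h
  refine (iInf₂_le (Set.range X) hX).trans ?_
  rw [← Set.image_univ]
  refine (Set.encard_image_le X _).trans ?_
  simp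

end Rounds

end MTC

namespace RAM

/-! ### Expected running times of programs -/

/-- The expected cost of `c` from a store, when halting in the store `s` costs `f s` in addition. -/
noncomputable def ert : Cmd → (Store → ℝ≥0∞) → Store → ℝ≥0∞
  | .assign i a, f => fun s => 1 + f (s.setReg i (a.eval s))
  | .store a b, f => fun s => 1 + f (s.setMem (a.eval s) (b.eval s))
  | .flip i, f => fun s => 1 + (f (s.setReg i 0) + f (s.setReg i 1)) / 2
  | .seq c d, f => fun s => 1 + ert c (ert d f) s
  | .ite a b c d, f => fun s => 1 + if a.eval s < b.eval s then ert c f s else ert d f s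
  | .while a b c, f =>
      sInf {I | ∀ s, 1 + (if a.eval s < b.eval s then ert c I s else f s) ≤ I s}

theorem ert_mono (c : Cmd) {f g : Store → ℝ≥0∞} (h : f ≤ g) : ert c f ≤ ert c g := by
  induction c generalizing f g with
  | assign i a => exact fun s => add_le_add le_rfl (h _)
  | store a b => exact fun s => add_le_add le_rfl (h _)
  | flip i => exact fun s => add_le_add le_rfl (ENNReal.div_le_div_right (add_le_add (h _) (h _)) 2)
  | seq c d ihc ihd => exact fun s => add_le_add le_rfl (ihc (ihd h) s)
  | ite a b c d ihc ihd =>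
    intro s
    refine add_le_add le_rfl ?_
    split_ifs
    · exact ihc h s
    · exact ihd h s
  | _ a b c ih =>
    refine sInf_le_sInf fun I hI s => le_trans (add_le_add le_rfl ?_) (hI s)
    split_ifs
    · exact le_rfl
    · exact h s

/-- By monotonicity, the infimum of the pre-fixed points is a pre-fixed point (half of
Knaster–Tarski). This half suffices, as only upper bounds on costs are needed. -/
theorem ert_while_unfold (a b : Expr) (c : Cmd) (f : Store → ℝ≥0∞) (s : Store) :
    1 + (if a.eval s < b.eval s then ert c (ert (.while a b c) f) s else f s) ≤
      ert (.while a b c) f s := by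
  rw [ert, sInf_apply]
  refine le_iInf fun I => le_trans (add_le_add le_rfl ?_) (I.2 s)
  split_ifs
  · exact ert_mono c (sInf_le I.2) s
  · exact le_rfl

/-- The rule for loops: `V` bounds the cost in terms of a ghost state `α`. -/
theorem ert_while_le {α : Type*} {a b : Expr} {c : Cmd} {f : Store → ℝ≥0∞}
    (Inv : α → Store → Prop) (V : α → ℝ≥0∞)
    (hexit : ∀ i s, Inv i s → ¬ a.eval s < b.eval s → 1 + f s ≤ V i)
    (hbody : ∀ i s, Inv i s → a.eval s < b.eval s →
      ∀ g : Store → ℝ≥0∞, (∀ j s', Inv j s' → g s' ≤ V j) → 1 + ert c g s ≤ V i)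
    {i : α} {s : Store} (h : Inv i s) : ert (.while a b c) f s ≤ V i := by
  -- The best bound over all ghost states compatible with the store is a pre-fixed point.
  have hI : ert (.while a b c) f ≤ fun s => ⨅ j, ⨅ _ : Inv j s, V j := by
    refine sInf_le fun s => le_iInf₂ fun j hj => ?_
    split_ifs with hg
    · exact hbody j s hj hg _ fun k s' hk => iInf₂_le k hk
    · exact hexit j s hj hg
  exact (hI s).trans (iInf₂_le i h)

/-- The expected cost of executing a list of commands. -/
noncomputable def ertList (h : Store → ℝ≥0∞) : List Cmd → Store → ℝ≥0∞
  | [] => h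
  | c :: K => ert c (ertList h K)

/-- The drift condition for the machine: the expected cost of the remaining commands is a potential
that drops by one per step until halting. -/
theorem indicator_add_expect_step_le (h : Store → ℝ≥0∞) (C : Config) :
    {C : Config | C.1 ≠ []}.indicator 1 C + (step C).expect (fun C => ertList h C.1 C.2) ≤
      ertList h C.1 C.2 := by
  obtain ⟨K, s⟩ := C
  match K with
  | [] => simp [step, PMF.expect_pure]
  | .assign i a :: K => simp [step, PMF.expect_pure, ertList, ert]
  | .store a b :: K => simp [step, PMF.expect_pure, ertList, ert]
  | .flip i :: K =>
    simp [step, PMF.expect_map, PMF.expect_uniform, ertList, ert, ENNReal.div_eq_inv_mul, add_comm]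
  | .seq c d :: K => simp [step, PMF.expect_pure, ertList, ert]
  | .ite a b c d :: K =>
    by_cases hg : a.eval s < b.eval s <;> simp [step, PMF.expect_pure, ertList, ert, hg]
  | .while a b c :: K =>
    refine le_trans (le_of_eq ?_) (ert_while_unfold a b c (ertList h K) s)
    by_cases hg : a.eval s < b.eval s <;> simp [step, PMF.expect_pure, ertList, hg]

theorem expectedTime_le (M : Cmd) (h : Store → ℝ≥0∞) (s : Store) :
    expectedTime M s ≤ ert M h s := by
  refine (PMF.tsum_toOuterMeasure_le (q := run M s) (fun t => rfl)
    (indicator_add_expect_step_le h)).trans ?_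
  rw [run, PMF.expect_pure]
  rfl

-- If a final store violating `Q` were reached with positive probability, its cost `⊤` would make
-- the total expected cost infinite.
open Classical in
theorem of_canHaltIn {M : Cmd} {s₀ s : Store} {Q : Store → Prop}
    (hM : ert M (fun s => if Q s then 0 else ⊤) s₀ ≠ ⊤) (hs : CanHaltIn M s₀ s) : Q s := by
  obtain ⟨t, ht⟩ := hs
  by_contra hQ
  refine hM (top_le_iff.1 ?_)
  have h1 := PMF.sum_toOuterMeasure_add_expect_le (q := run M s₀) (fun t => rfl)
    (indicator_add_expect_step_le fun s => if Q s then 0 else ⊤) t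
  rw [run, PMF.expect_pure] at h1
  refine le_trans ?_ (le_add_self.trans h1)
  refine le_trans ?_ (ENNReal.le_tsum ([], s))
  simp only [ertList, if_neg hQ]
  rw [ENNReal.mul_top ((PMF.mem_support_iff _ _).1 ht)]

/-! ### Rules for commands without coin flips -/

/-- From `s`, the command `c` costs at most `T` and halts in a store that satisfies `Q`. -/
def Det (c : Cmd) (s : Store) (T : ℕ) (Q : Store → Prop) : Prop :=
  ∀ (f : Store → ℝ≥0∞) (B : ℝ≥0∞), (∀ s', Q s' → f s' ≤ B) → ert c f s ≤ T + B

theorem Det.mono {c : Cmd} {s : Store} {T T' : ℕ} {Q Q' : Store → Prop} (h : Det c s T Q)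
    (hT : T ≤ T') (hQ : ∀ s', Q s' → Q' s') : Det c s T' Q' := fun f B hB =>
  (h f B fun s' hs' => hB s' (hQ s' hs')).trans (by gcongr)

theorem Det.assign {i : ℕ} {a : Expr} {s : Store} {Q : Store → Prop}
    (h : Q (s.setReg i (a.eval s))) : Det (.assign i a) s 1 Q := fun f B hB => by
  simpa [ert] using add_le_add (le_refl (1 : ℝ≥0∞)) (hB _ h)

theorem Det.seq {c d : Cmd} {s : Store} {T₁ T₂ : ℕ} {Q₁ Q₂ : Store → Prop}
    (hc : Det c s T₁ Q₁) (hd : ∀ s', Q₁ s' → Det d s' T₂ Q₂) :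
    Det (.seq c d) s (1 + T₁ + T₂) Q₂ := fun f B hB => by
  rw [ert]
  push_cast
  rw [add_assoc, add_assoc]
  gcongr
  exact hc _ _ fun s' hs' => hd s' hs' f B hB

theorem Det.assign_seq {i : ℕ} {a : Expr} {d : Cmd} {s : Store} {T : ℕ} {Q : Store → Prop}
    (h : Det d (s.setReg i (a.eval s)) T Q) : Det (.seq (.assign i a) d) s (T + 2) Q :=
  (Det.seq (Det.assign (Q := fun s' => s' = s.setReg i (a.eval s)) rfl)
    fun _ hs' => hs' ▸ h).mono (by omega) fun _ => id

theorem Det.ite {a b : Expr} {c d : Cmd} {s : Store} {T : ℕ} {Q : Store → Prop}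
    (hc : a.eval s < b.eval s → Det c s T Q) (hd : ¬ a.eval s < b.eval s → Det d s T Q) :
    Det (.ite a b c d) s (1 + T) Q := fun f B hB => by
  rw [ert]
  push_cast
  rw [add_assoc]
  gcongr
  split_ifs with h
  · exact hc h f B hB
  · exact hd h f B hB

/-- The rule for counting loops. -/
theorem Det.while {a b : Expr} {c : Cmd} {N T : ℕ} (Inv : ℕ → Store → Prop)
    (hle : ∀ j s, Inv j s → j ≤ N)
    (hguard : ∀ j s, Inv j s → (a.eval s < b.eval s ↔ j < N))
    (hbody : ∀ j s, j < N → Inv j s → Det c s T (Inv (j + 1))) {s : Store} (h : Inv 0 s) :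
    Det (.while a b c) s (N * (T + 1) + 1) (Inv N) := fun f B hB => by
  have := ert_while_le (f := f) (a := a) (b := b) (c := c) Inv
    (fun j => (((N - j) * (T + 1) + 1 : ℕ) : ℝ≥0∞) + B) ?_ ?_ h
  · simpa using this
  · intro j s hj hg
    have hjN : j = N := by
      have := hle j s hj
      have := (hguard j s hj).not.1 hg
      omega
    subst hjN
    simp only [Nat.sub_self, zero_mul, zero_add, Nat.cast_one]
    gcongr
    exact hB s hj
  · intro j s hj hg g hgV
    have hjN := (hguard j s hj).1 hg
    have := hbody j s hjN hj g _ fun s' hs' => hgV (j + 1) s' hs'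
    refine (add_le_add le_rfl this).trans (le_of_eq ?_)
    have hN : N - j = N - (j + 1) + 1 := by omega
    rw [hN]
    push_cast
    ring

@[simp]
theorem Store.reg_setReg (s : Store) (i v q : ℕ) :
    (s.setReg i v).reg q = if q = i then v else s.reg q := by
  simp [Store.setReg, Function.update_apply]

@[simp]
theorem Store.mem_setReg (s : Store) (i v : ℕ) : (s.setReg i v).mem = s.mem := rfl

@[simp]
theorem Store.reg_setMem (s : Store) (a v : ℕ) : (s.setMem a v).reg = s.reg := rfl

/-- The memories and the registers below `c` are the same. -/
structure Agree (c : ℕ) (s s' : Store) : Prop where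
  mem : s'.mem = s.mem
  reg : ∀ q < c, s'.reg q = s.reg q

theorem Agree.refl (c : ℕ) (s : Store) : Agree c s s := ⟨rfl, fun _ _ => rfl⟩

/-- The scratch registers of inner subroutines have higher numbers, so a call preserves what its
caller keeps in lower ones. -/
theorem Agree.trans {c d : ℕ} {s s' s'' : Store} (h : Agree c s s') (h' : Agree d s' s'')
    (hcd : c ≤ d) : Agree c s s'' :=
  ⟨h'.mem.trans h.mem, fun q hq => (h'.reg q (hq.trans_le hcd)).trans (h.reg q hq)⟩

theorem Agree.setReg {c i : ℕ} {s s' : Store} (h : Agree c s s') (v : ℕ) (hi : c ≤ i) :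
    Agree c s (s'.setReg i v) :=
  ⟨h.mem, fun q hq => by rw [Store.reg_setReg, if_neg (by omega), h.reg q hq]⟩

/-! ### Searching for a violated hyperedge -/

/-- The number of distinct values of `col` on `0, …, a - 1`. -/
def distinct (col : ℕ → ℕ) (a : ℕ) : ℕ := ((Finset.range a).image col).card

theorem distinct_succ (col : ℕ → ℕ) (a : ℕ) :
    distinct col (a + 1) = distinct col a + if ∃ b < a, col b = col a then 0 else 1 := by
  rw [distinct, distinct, Finset.range_add_one, Finset.image_insert]
  split_ifs with h
  · rw [Finset.insert_eq_of_mem, add_zero]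
    simpa using h
  · rw [Finset.card_insert_of_notMem]
    simpa using h

/-- The color of the vertex with index `t` of the hyperedge at address `reg 5`, in the coloring at
address `reg 8`. -/
def colorExpr (t : Expr) : Expr := .load (.plus (.reg 8) (.load (.plus (.reg 5) t)))

/-- The value of `colorExpr`. -/
def color (s : Store) (t : ℕ) : ℕ := s.mem (s.reg 8 + s.mem (s.reg 5 + t))

theorem Agree.color_eq {c : ℕ} {s s' : Store} (h : Agree c s s') (hc : 9 ≤ c) :
    color s' = color s := by
  funext t
  simp only [color, h.mem, h.reg 8 (by omega), h.reg 5 (by omega)]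

/-- Set `reg 11` to `1` if the color of the vertex with index `reg 10` does not occur before,
and to `0` otherwise. -/
def testNew : Cmd :=
  .seq (.assign 11 (.lit 1)) <| .seq (.assign 12 (.lit 0)) <|
  .while (.reg 12) (.reg 10) <| .seq
    (.ite (.plus (.minus (colorExpr (.reg 12)) (colorExpr (.reg 10)))
        (.minus (colorExpr (.reg 10)) (colorExpr (.reg 12)))) (.lit 1)
      (.assign 11 (.lit 0)) (.assign 11 (.reg 11)))
    (.assign 12 (.plus (.reg 12) (.lit 1)))

theorem det_testNew (s : Store) : Det testNew s (s.reg 10 * 5 + 5) fun s' =>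
    Agree 11 s s' ∧
      s'.reg 11 = if ∃ b < s.reg 10, color s b = color s (s.reg 10) then 0 else 1 := by
  refine Det.assign_seq (Det.assign_seq (Det.mono (Det.while (N := s.reg 10) (T := 4)
    (fun j s' => Agree 11 s s' ∧ s'.reg 12 = j ∧ j ≤ s.reg 10 ∧
      s'.reg 11 = if ∃ b < j, color s b = color s (s.reg 10) then 0 else 1) ?_ ?_ ?_ ?_)
    le_rfl ?_))
  · exact fun j s' h => h.2.2.1
  · rintro j s' ⟨h1, h2, h3, h4⟩
    simp only [Expr.eval, h2, h1.reg 10 (by omega)]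
  · rintro j s' hj ⟨h1, h2, h3, h4⟩
    have hb : (colorExpr (.reg 12)).eval s' = color s j := by
      rw [← h1.color_eq (by omega)]
      simp only [colorExpr, Expr.eval, color, h2]
    have ha : (colorExpr (.reg 10)).eval s' = color s (s.reg 10) := by
      rw [← h1.color_eq (by omega)]
      simp only [colorExpr, Expr.eval, color, h1.reg 10 (by omega)]
    have hex : (∃ b < j + 1, color s b = color s (s.reg 10)) ↔
        (∃ b < j, color s b = color s (s.reg 10)) ∨ color s j = color s (s.reg 10) := by
      constructor
      · rintro ⟨b, hb, h⟩
        rcases Nat.lt_succ_iff_lt_or_eq.1 hb with hb | rfl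
        · exact Or.inl ⟨b, hb, h⟩
        · exact Or.inr h
      · rintro (⟨b, hb, h⟩ | h)
        · exact ⟨b, by omega, h⟩
        · exact ⟨j, by omega, h⟩
    refine Det.mono (Det.seq (T₁ := 2) (T₂ := 1) (Q₁ := fun s'' => Agree 11 s s'' ∧
      s''.reg 12 = j ∧
      s''.reg 11 = if ∃ b < j + 1, color s b = color s (s.reg 10) then 0 else 1)
      (Det.ite (fun h => Det.assign ?_) (fun h => Det.assign ?_)) ?_) le_rfl fun _ => id
    -- The sum of the two truncated differences is below 1 exactly when the two colors are equal.
    · simp only [Expr.eval, ha, hb] at h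
      refine ⟨h1.setReg _ le_rfl, by simp [h2], ?_⟩
      rw [if_pos (hex.2 (Or.inr (by omega)))]
      simp [Expr.eval]
    · simp only [Expr.eval, ha, hb] at h
      refine ⟨h1.setReg _ le_rfl, by simp [h2], ?_⟩
      have hne : ¬ color s j = color s (s.reg 10) := by omega
      simp only [hex, hne, or_false]
      simp [Expr.eval, h4]
    · rintro s'' ⟨h1, h2, h3⟩
      refine Det.assign ⟨h1.setReg _ (by omega), by simp [Expr.eval, h2], hj, by simp [h3]⟩
  · refine ⟨((Agree.refl 11 s).setReg _ le_rfl).setReg _ (by omega), by simp [Expr.eval],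
      Nat.zero_le _, by simp [Expr.eval]⟩
  · rintro s' ⟨h1, h2, h3, h4⟩
    exact ⟨h1, h4⟩

/-- Clear `reg 6` if the hyperedge at address `reg 5` has at least `p` colors in the coloring at
address `reg 8`. -/
def testRow : Cmd :=
  .seq (.assign 9 (.lit 0)) <| .seq (.assign 10 (.lit 0)) <| .seq
    (.while (.reg 10) (.load (.lit 2)) <| .seq testNew <|
      .seq (.assign 9 (.plus (.reg 9) (.reg 11))) (.assign 10 (.plus (.reg 10) (.lit 1))))
    (.ite (.reg 9) (.load (.lit 4)) (.assign 9 (.reg 9)) (.assign 6 (.lit 0)))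

theorem det_testRow (s : Store) {k p : ℕ} (hk : s.mem 2 = k) (hp : s.mem 4 = p) :
    Det testRow s (k * (5 * k + 10) + 8) fun s' => s'.mem = s.mem ∧
      (∀ q < 9, q ≠ 6 → s'.reg q = s.reg q) ∧
      s'.reg 6 = if distinct (color s) k < p then s.reg 6 else 0 := by
  refine Det.mono (Det.assign_seq (Det.assign_seq (Det.seq (Det.while (N := k) (T := 5 * k + 9)
    (fun a s' => Agree 9 s s' ∧ s'.reg 10 = a ∧ a ≤ k ∧ s'.reg 9 = distinct (color s) a)
    ?_ ?_ ?_ ?_) (T₂ := 2) ?_))) (le_of_eq (by ring)) fun _ => id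
  · exact fun j s' h => h.2.2.1
  · rintro a s' ⟨h1, h2, h3, h4⟩
    simp only [Expr.eval, h2, h1.mem, hk]
  · rintro a s' ha ⟨h1, h2, h3, h4⟩
    refine Det.mono (Det.seq (det_testNew s') fun s'' hs'' => Det.assign_seq (Det.assign ?_))
      (T' := 5 * k + 9) (by rw [h2]; omega) fun _ => id
    obtain ⟨h5, h6⟩ := hs''
    rw [h2, h1.color_eq le_rfl] at h6
    refine ⟨((h1.trans h5 (by omega)).setReg _ le_rfl).setReg _ (by omega), ?_, ha, ?_⟩
    · simp [Expr.eval, h5.reg 10 (by omega), h2]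
    · simp only [Expr.eval, Store.reg_setReg, h5.reg 9 (by omega), h4, h6, distinct_succ]
      simp
  · refine ⟨((Agree.refl 9 s).setReg _ le_rfl).setReg _ (by omega), by simp [Expr.eval],
      Nat.zero_le _, by simp [Expr.eval, distinct]⟩
  · rintro s' ⟨h1, h2, h3, h4⟩
    refine Det.ite (T := 1) (fun h => Det.assign ?_) (fun h => Det.assign ?_)
    · simp only [Expr.eval, h4, h1.mem, hp] at h
      refine ⟨h1.mem, fun q hq _ => ?_, ?_⟩
      · rw [Store.reg_setReg, if_neg (by omega), h1.reg q hq]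
      · simp [h, h1.reg 6 (by omega)]
    · simp only [Expr.eval, h4, h1.mem, hp] at h
      refine ⟨h1.mem, fun q hq h6 => ?_, ?_⟩
      · rw [Store.reg_setReg, if_neg h6, h1.reg q hq]
      · simp [h, Expr.eval]

/-- No coloring stored from address `A` on has at least `p` colors on the hyperedge at
address `e`. -/
def BadAt (mem : ℕ → ℕ) (n k p x A e : ℕ) : Prop :=
  ∀ i < x, distinct (fun t => mem (A + i * n + mem (e + t))) k < p

/-- Set the flag `reg 2` and put the address of the hyperedge at address `reg 5` into `reg 3` if
this hyperedge is violated. -/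
def testEdge : Cmd :=
  .seq (.assign 6 (.lit 1)) <| .seq (.assign 7 (.lit 0)) <| .seq (.assign 8 (.reg 0)) <| .seq
    (.while (.reg 7) (.load (.lit 5)) <| .seq testRow <|
      .seq (.assign 8 (.plus (.reg 8) (.load (.lit 0)))) (.assign 7 (.plus (.reg 7) (.lit 1))))
    (.ite (.lit 0) (.reg 6) (.seq (.assign 2 (.lit 1)) (.assign 3 (.reg 5)))
      (.assign 6 (.reg 6)))

theorem det_testEdge (s : Store) {n k p x : ℕ} (hn : s.mem 0 = n) (hk : s.mem 2 = k)
    (hp : s.mem 4 = p) (hx : s.mem 5 = x) :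
    Det testEdge s (x * (k * (5 * k + 10) + 13) + 12) fun s' => s'.mem = s.mem ∧
      s'.reg 0 = s.reg 0 ∧ s'.reg 4 = s.reg 4 ∧ s'.reg 5 = s.reg 5 ∧
      ((BadAt s.mem n k p x (s.reg 0) (s.reg 5) ∧ s'.reg 2 = 1 ∧ s'.reg 3 = s.reg 5) ∨
       (¬ BadAt s.mem n k p x (s.reg 0) (s.reg 5) ∧ s'.reg 2 = s.reg 2 ∧
        s'.reg 3 = s.reg 3)) := by
  refine Det.mono (Det.assign_seq (Det.assign_seq (Det.assign_seq (Det.seq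
    (Det.while (N := x) (T := k * (5 * k + 10) + 12)
    (fun i s' => Agree 6 s s' ∧ s'.reg 7 = i ∧ i ≤ x ∧ s'.reg 8 = s.reg 0 + i * n ∧
      (0 < s'.reg 6 ↔ BadAt s.mem n k p i (s.reg 0) (s.reg 5)))
    ?_ ?_ ?_ ?_) (T₂ := 4) ?_)))) (le_of_eq (by ring)) fun _ => id
  · exact fun j s' h => h.2.2.1
  · rintro i s' ⟨h1, h2, h3, h4, h5⟩
    simp only [Expr.eval, h2, h1.mem, hx]
  · rintro i s' hi ⟨h1, h2, h3, h4, h5⟩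
    refine Det.mono (Det.seq (det_testRow s' (k := k) (p := p) (by rw [h1.mem, hk])
      (by rw [h1.mem, hp])) fun s'' hs'' => Det.assign_seq (Det.assign ?_))
      (le_of_eq (by ring)) fun _ => id
    obtain ⟨g1, g2, g3⟩ := hs''
    have hA : Agree 6 s s'' :=
      ⟨g1.trans h1.mem, fun q hq => (g2 q (by omega) (by omega)).trans (h1.reg q hq)⟩
    refine ⟨(hA.setReg _ (by omega)).setReg _ (by omega), ?_, hi, ?_, ?_⟩
    · simp [Expr.eval, g2 7, h2]
    · simp only [Expr.eval, Store.reg_setReg, g2 8 (by omega) (by omega), h4, g1, h1.mem, hn]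
      simp
      ring
    · have hcol : color s' = fun t => s.mem (s.reg 0 + i * n + s.mem (s.reg 5 + t)) := by
        funext t
        simp only [color, h1.mem, h4, h1.reg 5 (by omega)]
      have hsucc : BadAt s.mem n k p (i + 1) (s.reg 0) (s.reg 5) ↔
          BadAt s.mem n k p i (s.reg 0) (s.reg 5) ∧ distinct (color s') k < p := by
        rw [hcol]
        constructor
        · exact fun h => ⟨fun i' hi' => h i' (by omega), h i (by omega)⟩
        · rintro ⟨h, h'⟩ i' hi'
          rcases Nat.lt_succ_iff_lt_or_eq.1 hi' with hi' | rfl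
          · exact h i' hi'
          · exact h'
      rw [hsucc, ← h5]
      simp only [Store.reg_setReg, g3]
      split_ifs <;> simp_all
  · refine ⟨(((Agree.refl 6 s).setReg _ le_rfl).setReg _ (by omega)).setReg _ (by omega),
      by simp [Expr.eval], Nat.zero_le _, by simp [Expr.eval], by simp [Expr.eval, BadAt]⟩
  · rintro s' ⟨h1, h2, h3, h4, h5⟩
    refine Det.ite (T := 3) (fun h => Det.assign_seq (Det.assign ?_))
      (fun h => (Det.assign ?_).mono (by omega) fun _ => id)
    · refine ⟨by simp [h1.mem], by simp [h1.reg], by simp [h1.reg], by simp [h1.reg],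
        Or.inl ⟨h5.1 h, by simp [Expr.eval], by simp [Expr.eval, h1.reg]⟩⟩
    · refine ⟨by simp [h1.mem], by simp [h1.reg], by simp [h1.reg], by simp [h1.reg],
        Or.inr ⟨fun hb => h (h5.2 hb), by simp [h1.reg], by simp [h1.reg]⟩⟩

/-- Set the flag `reg 2` to `1` and put the address of a violated hyperedge into `reg 3`, or set
the flag to `0` if there is none. -/
def findBad : Cmd :=
  .seq (.assign 2 (.lit 0)) <| .seq (.assign 4 (.lit 0)) <| .seq (.assign 5 (.lit 6)) <|
  .while (.reg 4) (.load (.lit 1)) <| .seq testEdge <|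
    .seq (.assign 5 (.plus (.reg 5) (.load (.lit 2)))) (.assign 4 (.plus (.reg 4) (.lit 1)))

theorem det_findBad (s : Store) {n m k p x : ℕ} (hn : s.mem 0 = n) (hm : s.mem 1 = m)
    (hk : s.mem 2 = k) (hp : s.mem 4 = p) (hx : s.mem 5 = x) :
    Det findBad s (m * (x * (k * (5 * k + 10) + 13) + 17) + 7) fun s' => s'.mem = s.mem ∧
      s'.reg 0 = s.reg 0 ∧
      ((s'.reg 2 = 0 ∧ ∀ j < m, ¬ BadAt s.mem n k p x (s.reg 0) (6 + j * k)) ∨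
       (s'.reg 2 = 1 ∧ ∃ j < m, BadAt s.mem n k p x (s.reg 0) (6 + j * k) ∧
        s'.reg 3 = 6 + j * k)) := by
  refine Det.mono (Det.assign_seq (Det.assign_seq (Det.assign_seq
    (Det.while (N := m) (T := x * (k * (5 * k + 10) + 13) + 16)
    (fun j s' => s'.mem = s.mem ∧ s'.reg 0 = s.reg 0 ∧ s'.reg 4 = j ∧ j ≤ m ∧
      s'.reg 5 = 6 + j * k ∧
      ((s'.reg 2 = 0 ∧ ∀ j' < j, ¬ BadAt s.mem n k p x (s.reg 0) (6 + j' * k)) ∨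
       (s'.reg 2 = 1 ∧ ∃ j' < j, BadAt s.mem n k p x (s.reg 0) (6 + j' * k) ∧
        s'.reg 3 = 6 + j' * k)))
    ?_ ?_ ?_ ?_)))) (le_of_eq (by ring)) ?_
  · exact fun j s' h => h.2.2.2.1
  · rintro j s' ⟨h1, h2, h3, h4, h5, h6⟩
    simp only [Expr.eval, h3, h1, hm]
  · rintro j s' hj ⟨h1, h2, h3, h4, h5, h6⟩
    refine Det.mono (Det.seq (det_testEdge s' (n := n) (k := k) (p := p) (x := x)
      (by rw [h1, hn]) (by rw [h1, hk]) (by rw [h1, hp]) (by rw [h1, hx]))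
      fun s'' hs'' => Det.assign_seq (Det.assign ?_)) (le_of_eq (by ring)) fun _ => id
    obtain ⟨g1, g2, g3, g4, g5⟩ := hs''
    rw [h1, h2, h5] at g5
    refine ⟨by simp [g1, h1], by simp [g2, h2], by simp [Expr.eval, g3, h3], hj, ?_, ?_⟩
    · simp only [Expr.eval, Store.reg_setReg, g4, g1, h5, h1, hk]
      simp
      ring
    · simp only [Store.reg_setReg]
      rcases g5 with ⟨hb, e2, e3⟩ | ⟨hb, e2, e3⟩
      · exact Or.inr ⟨by simp [e2], j, by omega, hb, by simp [e3]⟩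
      · rcases h6 with ⟨f1, f2⟩ | ⟨f1, j', hj', f2, f3⟩
        · refine Or.inl ⟨by simp [e2, f1], fun j' hj' => ?_⟩
          rcases Nat.lt_succ_iff_lt_or_eq.1 hj' with hj' | rfl
          · exact f2 j' hj'
          · exact hb
        · exact Or.inr ⟨by simp [e2, f1], j', by omega, f2, by simp [e3, f3]⟩
  · exact ⟨rfl, by simp, by simp [Expr.eval], Nat.zero_le _, by simp [Expr.eval],
      Or.inl ⟨by simp [Expr.eval], by simp⟩⟩
  · rintro s' ⟨h1, h2, h3, h4, h5, h6⟩
    exact ⟨h1, h2, h6⟩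

/-! ### Drawing a uniform color -/

/-- The average of `G` over the `2 ^ m` numbers with the leading binary digits of `v`. -/
noncomputable def dyadicMean (G : ℕ → ℝ≥0∞) (m v : ℕ) : ℝ≥0∞ :=
  (2 ^ m : ℝ≥0∞)⁻¹ * ∑ u ∈ Finset.range (2 ^ m), G (v * 2 ^ m + u)

theorem dyadicMean_zero (G : ℕ → ℝ≥0∞) (v : ℕ) : dyadicMean G 0 v = G v := by
  simp [dyadicMean]

/-- The next binary digit selects the lower or the upper half of the range, with equal odds. -/
theorem dyadicMean_succ (G : ℕ → ℝ≥0∞) (m v : ℕ) :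
    (dyadicMean G m (2 * v) + dyadicMean G m (2 * v + 1)) / 2 = dyadicMean G (m + 1) v := by
  have h2 : (2 ^ (m + 1) : ℝ≥0∞)⁻¹ = (2 ^ m : ℝ≥0∞)⁻¹ * 2⁻¹ := by
    rw [pow_succ, ENNReal.mul_inv (Or.inr (by simp)) (Or.inr (by simp))]
  have hsum : ∑ u ∈ Finset.range (2 ^ (m + 1)), G (v * 2 ^ (m + 1) + u) =
      ∑ u ∈ Finset.range (2 ^ m), G (2 * v * 2 ^ m + u) +
        ∑ u ∈ Finset.range (2 ^ m), G ((2 * v + 1) * 2 ^ m + u) := by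
    rw [pow_succ, mul_two, Finset.sum_range_add]
    congr 1
    · exact Finset.sum_congr rfl fun u _ => by congr 1; ring
    · exact Finset.sum_congr rfl fun u _ => by congr 1; ring
  rw [dyadicMean, dyadicMean, dyadicMean, hsum, h2, ENNReal.div_eq_inv_mul]
  ring

/-- Append random bits to `reg 7` until `reg 8` has reached the number of colors. -/
def drawBits : Cmd :=
  .while (.reg 8) (.load (.lit 3)) <| .seq (.flip 9) <|
    .seq (.assign 7 (.plus (.plus (.reg 7) (.reg 7)) (.reg 9)))
      (.assign 8 (.plus (.reg 8) (.reg 8)))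

theorem ert_drawBits_le {s : Store} {r : ℕ} (hr : s.mem 3 = r) {f : Store → ℝ≥0∞}
    {G : ℕ → ℝ≥0∞} (hf : ∀ u s', Agree 7 s s' → s'.reg 7 = u → f s' ≤ G u)
    (h7 : s.reg 7 = 0) (h8 : s.reg 8 = 1) :
    ert drawBits f s ≤ ((Nat.clog 2 r * 6 + 1 : ℕ) : ℝ≥0∞) + dyadicMean G (Nat.clog 2 r) 0 := by
  set b := Nat.clog 2 r with hb
  have hguard : ∀ j, 2 ^ j < r ↔ j < b := fun j => (Nat.lt_clog_iff_pow_lt one_lt_two).symm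
  have := ert_while_le (f := f) (a := .reg 8) (b := .load (.lit 3))
    (c := .seq (.flip 9) <| .seq (.assign 7 (.plus (.plus (.reg 7) (.reg 7)) (.reg 9)))
      (.assign 8 (.plus (.reg 8) (.reg 8))))
    (fun (i : ℕ × ℕ) s' => Agree 7 s s' ∧ s'.reg 7 = i.2 ∧ s'.reg 8 = 2 ^ i.1 ∧ i.1 ≤ b)
    -- The ghost state is the number of bits drawn and their value; the bound averages over the bits
    -- still missing, at six steps per bit.
    (fun i => (((b - i.1) * 6 + 1 : ℕ) : ℝ≥0∞) + dyadicMean G (b - i.1) i.2)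
    ?_ ?_ (i := (0, 0)) (s := s) ⟨Agree.refl 7 s, h7, by simpa using h8, Nat.zero_le _⟩
  · simpa [drawBits] using this
  · rintro ⟨j, v⟩ s' ⟨h1, h2, h3, h4⟩ hg
    simp only [Expr.eval, h3, h1.mem, hr, hguard] at hg
    have hj : b - j = 0 := by omega
    simp only [hj, dyadicMean_zero, zero_mul, zero_add, Nat.cast_one]
    gcongr
    exact hf v s' h1 h2
  · rintro ⟨j, v⟩ s' ⟨h1, h2, h3, h4⟩ hg g hgV
    simp only [Expr.eval, h3, h1.mem, hr, hguard] at hg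
    simp only at h2 h3 hg
    obtain ⟨m, hm⟩ : ∃ m, b - j = m + 1 := ⟨b - j - 1, by omega⟩
    have hm' : b - (j + 1) = m := by omega
    have hbit : ∀ t, t = 0 ∨ t = 1 → g (((s'.setReg 9 t).setReg 7
        ((s'.setReg 9 t).reg 7 + (s'.setReg 9 t).reg 7 + (s'.setReg 9 t).reg 9)).setReg 8
        (((s'.setReg 9 t).setReg 7
        ((s'.setReg 9 t).reg 7 + (s'.setReg 9 t).reg 7 + (s'.setReg 9 t).reg 9)).reg 8 +
        ((s'.setReg 9 t).setReg 7
        ((s'.setReg 9 t).reg 7 + (s'.setReg 9 t).reg 7 + (s'.setReg 9 t).reg 9)).reg 8)) ≤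
        ((m * 6 + 1 : ℕ) : ℝ≥0∞) + dyadicMean G m (2 * v + t) := by
      intro t _
      have := hgV (j + 1, 2 * v + t) _ ⟨((h1.setReg (i := 9) t (by omega)).setReg (i := 7)
        ((s'.setReg 9 t).reg 7 + (s'.setReg 9 t).reg 7 + (s'.setReg 9 t).reg 9)
        le_rfl).setReg (i := 8) (((s'.setReg 9 t).setReg 7
        ((s'.setReg 9 t).reg 7 + (s'.setReg 9 t).reg 7 + (s'.setReg 9 t).reg 9)).reg 8 +
        ((s'.setReg 9 t).setReg 7
        ((s'.setReg 9 t).reg 7 + (s'.setReg 9 t).reg 7 + (s'.setReg 9 t).reg 9)).reg 8)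
        (by omega), by simp [h2]; ring, by simp [h3]; ring, by simp only; omega⟩
      simpa only [hm'] using this
    simp only [ert, Expr.eval]
    simp only [hm]
    rw [← dyadicMean_succ]
    have h0 := hbit 0 (Or.inl rfl)
    have h1' := hbit 1 (Or.inr rfl)
    rw [add_zero] at h0
    have hhalf : ∀ c a a' : ℝ≥0∞, (c + a + (c + a')) / 2 = c + (a + a') / 2 := by
      intro c a a'
      rw [add_add_add_comm, ENNReal.add_div, ENNReal.add_div, ENNReal.add_halves]
    have hthree : ∀ y a : ℝ≥0∞, y ≤ ((m * 6 + 1 : ℕ) : ℝ≥0∞) + a →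
        1 + (1 + (1 + y)) ≤ ((m * 6 + 4 : ℕ) : ℝ≥0∞) + a := by
      intro y a hy
      refine (add_le_add le_rfl (add_le_add le_rfl (add_le_add le_rfl hy))).trans (le_of_eq ?_)
      push_cast
      ring
    refine (add_le_add le_rfl (add_le_add le_rfl (add_le_add le_rfl
      (ENNReal.div_le_div_right (add_le_add (hthree _ _ h0) (hthree _ _ h1')) 2)))).trans
      (le_of_eq ?_)
    rw [hhalf]
    push_cast
    ring

/-- Put a uniform number below the number of colors into `reg 7`. -/
def drawColor : Cmd :=
  .seq (.assign 7 (.load (.lit 3))) <|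
  .while (.load (.lit 3)) (.plus (.reg 7) (.lit 1)) <|
    .seq (.assign 7 (.lit 0)) <| .seq (.assign 8 (.lit 1)) drawBits

/-- Rejection sampling: a trial yields a uniform number below `2 ^ b < 2 r`, so it is accepted with
probability above one half, and an accepted number is uniform below `r`. `V v` bounds the cost from
the loop test with `v` in register 7, and `hdy` is the inequality that makes it self-consistent. -/
theorem ert_drawColor_le {s : Store} {r : ℕ} (hr : s.mem 3 = r) (hr0 : 0 < r)
    {f : Store → ℝ≥0∞} {G : ℕ → ℝ≥0∞}
    (hf : ∀ u s', u < r → Agree 7 s s' → s'.reg 7 = u → f s' ≤ G u) :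
    ert drawColor f s ≤ ((Nat.clog 2 r * 12 + 16 : ℕ) : ℝ≥0∞) +
      (r : ℝ≥0∞)⁻¹ * ∑ u ∈ Finset.range r, G u := by
  set b := Nat.clog 2 r with hb
  set A := (r : ℝ≥0∞)⁻¹ * ∑ u ∈ Finset.range r, G u with hA
  set c := 6 * b + 6 with hc
  set V : ℕ → ℝ≥0∞ := fun v => if v < r then 1 + G v else ((2 * (c + 1) : ℕ) : ℝ≥0∞) + A with hV
  have hVlt : ∀ v, v < r → V v = 1 + G v := fun v hv => if_pos hv
  have hVge : ∀ v, ¬ v < r → V v = ((2 * (c + 1) : ℕ) : ℝ≥0∞) + A := fun v hv => if_neg hv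
  have hdy : ((c : ℕ) : ℝ≥0∞) + dyadicMean V b 0 ≤ ((2 * (c + 1) : ℕ) : ℝ≥0∞) + A := by
    obtain ⟨m, hm⟩ : ∃ m, 2 ^ b = r + m :=
      Nat.exists_eq_add_of_le (Nat.le_pow_clog one_lt_two r)
    have hmr : m ≤ r := by
      rcases Nat.eq_zero_or_pos b with h0 | h0
      · rw [h0] at hm; omega
      · have h1 : 2 ^ (b - 1) < r := (Nat.lt_clog_iff_pow_lt one_lt_two).1 (by omega)
        have h2 : 2 ^ b = 2 * 2 ^ (b - 1) := by
          rw [← pow_succ']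
          congr 1
          omega
        omega
    have hr1 : (r : ℝ≥0∞) ≠ 0 := by exact_mod_cast hr0.ne'
    have hsumG : ∑ u ∈ Finset.range r, G u = r * A := by
      rw [hA, ← mul_assoc, ENNReal.mul_inv_cancel hr1 (ENNReal.natCast_ne_top r), one_mul]
    have hsum : ∑ u ∈ Finset.range (2 ^ b), V (0 * 2 ^ b + u) =
        ((r + m * (2 * (c + 1)) : ℕ) : ℝ≥0∞) + (2 ^ b : ℝ≥0∞) * A := by
      have hq : (2 ^ b : ℝ≥0∞) = r + m := by exact_mod_cast hm
      rw [hm, hq, Finset.sum_range_add]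
      have e1 : ∑ u ∈ Finset.range r, V (0 * (r + m) + u) = r + r * A := by
        rw [← hsumG, Finset.sum_congr rfl fun u hu => by
          rw [zero_mul, zero_add, hVlt u (Finset.mem_range.1 hu)]]
        rw [Finset.sum_add_distrib]
        simp
      have e2 : ∑ u ∈ Finset.range m, V (0 * (r + m) + (r + u)) =
          m * (((2 * (c + 1) : ℕ) : ℝ≥0∞) + A) := by
        rw [Finset.sum_congr rfl fun u hu => by
          rw [zero_mul, zero_add, hVge _ (by omega)]]
        simp only [Finset.sum_const, Finset.card_range, nsmul_eq_mul]
      rw [e1, e2]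
      push_cast
      ring
    have hq0 : (2 ^ b : ℝ≥0∞) ≠ 0 := by simp
    have hqt : (2 ^ b : ℝ≥0∞) ≠ ⊤ := by simp
    rw [dyadicMean, hsum, mul_add, ← mul_assoc _ _ A, ENNReal.inv_mul_cancel hq0 hqt, one_mul,
      ← add_assoc]
    gcongr
    -- This is where `m ≤ r`, at most as many rejected values as accepted ones, enters.
    have hnat : r + m * (2 * (c + 1)) ≤ 2 ^ b * (c + 2) := by
      rw [hm]
      nlinarith
    calc ((c : ℕ) : ℝ≥0∞) + (2 ^ b : ℝ≥0∞)⁻¹ * ((r + m * (2 * (c + 1)) : ℕ) : ℝ≥0∞)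
        ≤ (c : ℝ≥0∞) + (2 ^ b : ℝ≥0∞)⁻¹ * ((2 ^ b * (c + 2) : ℕ) : ℝ≥0∞) := by gcongr
      _ = _ := by
        push_cast
        rw [← mul_assoc, ENNReal.inv_mul_cancel hq0 hqt]
        ring
  have hloop := ert_while_le (f := f) (a := .load (.lit 3)) (b := .plus (.reg 7) (.lit 1))
    (c := .seq (.assign 7 (.lit 0)) <| .seq (.assign 8 (.lit 1)) drawBits)
    (fun v s' => Agree 7 s s' ∧ s'.reg 7 = v) V ?_ ?_
    -- The initial value `r` counts as rejected and so forces a first trial.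
    (i := r) (s := s.setReg 7 r) ⟨(Agree.refl 7 s).setReg _ le_rfl, by simp⟩
  · rw [drawColor, ert]
    simp only [ert, Expr.eval, hr]
    simp only [ert] at hloop
    refine (add_le_add le_rfl (add_le_add le_rfl hloop)).trans (le_of_eq ?_)
    rw [hVge r (lt_irrefl r), hc]
    push_cast
    ring
  · rintro v s' ⟨h1, h2⟩ hg
    simp only [Expr.eval, h1.mem, hr, h2] at hg
    have hv : v < r := by omega
    rw [hVlt v hv]
    gcongr
    exact hf v s' hv h1 h2
  · rintro v s' ⟨h1, h2⟩ hg g hgV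
    simp only [Expr.eval, h1.mem, hr, h2] at hg
    have hv : ¬ v < r := by omega
    rw [hVge v hv]
    refine le_trans ?_ hdy
    have := ert_drawBits_le (s := (s'.setReg 7 0).setReg 8 1) (r := r) (f := g) (G := V)
      (by simp [h1.mem, hr]) (fun u s'' h h' => hgV u s'' ⟨((h1.setReg 0 le_rfl).setReg 1
        (by omega)).trans h le_rfl, h'⟩) (by simp) (by simp)
    simp only [ert, Expr.eval]
    refine (add_le_add le_rfl (add_le_add le_rfl (add_le_add le_rfl
      (add_le_add le_rfl (add_le_add le_rfl this))))).trans (le_of_eq ?_)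
    rw [← hb, hc]
    push_cast
    ring

end RAM

/-! ### Refreshing a single cell -/

namespace MTC

/-- One coordinate of a uniform family is uniform: the mean is invariant under adding a constant `c`
of `Fin r` to all colors, and averaging over `c` replaces the color `Y i v` by all colors. This
links the machine's single draws to `refresh`. -/
theorem refresh_singleton {V : Type*} [Fintype V] [DecidableEq V] {r x : ℕ} [NeZero r]
    (i : Fin x) (v : V) (g : (Fin x → V → Fin r) → ℝ≥0∞) (X : Fin x → V → Fin r) :
    refresh {(i, v)} g X = (r : ℝ≥0∞)⁻¹ * ∑ u : Fin r, g (mix {(i, v)} (fun _ _ => u) X) := by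
  set h : Fin r → ℝ≥0∞ := fun u => g (mix {(i, v)} (fun _ _ => u) X) with hh
  have h1 : refresh {(i, v)} g X = mean fun Y : Fin x → V → Fin r => h (Y i v) := by
    refine congrArg mean (funext fun Y => congrArg g ?_)
    funext j w
    simp only [mix, Finset.mem_singleton, Prod.mk.injEq]
    split_ifs with hjw
    · rw [hjw.1, hjw.2]
    · rfl
  have hshift : ∀ c : Fin r, (mean fun Y : Fin x → V → Fin r => h (Y i v)) =
      mean fun Y : Fin x → V → Fin r => h (Y i v + c) := by
    intro c
    unfold mean
    congr 1
    exact Fintype.sum_equiv (Equiv.subRight fun _ _ => c) _ _ fun Y => by simp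
  have hr : (r : ℝ≥0∞) ≠ 0 := by exact_mod_cast NeZero.ne r
  have hsum : (r : ℝ≥0∞) * (mean fun Y : Fin x → V → Fin r => h (Y i v)) = ∑ u, h u := by
    calc _ = ∑ c : Fin r, mean fun Y : Fin x → V → Fin r => h (Y i v + c) := by
          rw [← Finset.sum_congr rfl fun c _ => hshift c]
          simp
      _ = mean fun Y : Fin x → V → Fin r => ∑ c : Fin r, h (Y i v + c) := (mean_sum _ _).symm
      _ = mean fun _ : Fin x → V → Fin r => ∑ u, h u :=
          congrArg mean (funext fun Y => Fintype.sum_equiv (Equiv.addLeft (Y i v)) _ _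
            fun c => rfl)
      _ = _ := mean_const _
  rw [h1, ← hsum, ← mul_assoc, ENNReal.inv_mul_cancel hr (ENNReal.natCast_ne_top r), one_mul]

end MTC

namespace RAM

open MTC

/-! ### Drawing new colors -/

/-- The memory holds the instance and, from address `6 + |L| k` on, the colorings `X`. -/
structure Encodes {n r x : ℕ} (L : List (List (Fin n))) (k p : ℕ) (X : Fin x → Fin n → Fin r)
    (mem : ℕ → ℕ) : Prop where
  n_eq : mem 0 = n
  m_eq : mem 1 = L.length
  k_eq : mem 2 = k
  r_eq : mem 3 = r
  p_eq : mem 4 = p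
  x_eq : mem 5 = x
  edge : ∀ (j : ℕ) (hj : j < L.length) (a : ℕ) (ha : a < L[j].length),
    mem (6 + j * k + a) = L[j][a].val
  color : ∀ i v, mem (6 + L.length * k + i.val * n + v.val) = (X i v).val

variable {n r x : ℕ} {L : List (List (Fin n))} {k p : ℕ}

theorem cell_inj {i j n v w : ℕ} (hv : v < n) (hw : w < n) (h : i * n + v = j * n + w) :
    i = j ∧ v = w := by
  have hi : i = j := by
    have h1 : (i * n + v) / n = i := by
      rw [mul_comm, Nat.mul_add_div (by omega), Nat.div_eq_of_lt hv, add_zero]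
    have h2 : (j * n + w) / n = j := by
      rw [mul_comm, Nat.mul_add_div (by omega), Nat.div_eq_of_lt hw, add_zero]
    rw [← h1, ← h2, h]
  subst hi
  exact ⟨rfl, by omega⟩

theorem Encodes.setMem {X : Fin x → Fin n → Fin r} {s : Store} (h : Encodes L k p X s.mem)
    (hL : ∀ l ∈ L, l.length = k) (i : Fin x) (v : Fin n) (u : Fin r) :
    Encodes L k p (mix {(i, v)} (fun _ _ => u) X)
      (s.setMem (6 + L.length * k + i.val * n + v.val) u.val).mem := by
  have hne : ∀ a, a < 6 + L.length * k → Function.update s.mem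
      (6 + L.length * k + i.val * n + v.val) u.val a = s.mem a := fun a ha =>
    Function.update_of_ne (by omega) _ _
  constructor
  · exact (hne 0 (by omega)).trans h.n_eq
  · exact (hne 1 (by omega)).trans h.m_eq
  · exact (hne 2 (by omega)).trans h.k_eq
  · exact (hne 3 (by omega)).trans h.r_eq
  · exact (hne 4 (by omega)).trans h.p_eq
  · exact (hne 5 (by omega)).trans h.x_eq
  · intro j hj a ha
    refine (hne _ ?_).trans (h.edge j hj a ha)
    rw [hL _ (List.getElem_mem hj)] at ha
    have : (j + 1) * k ≤ L.length * k := Nat.mul_le_mul_right k hj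
    rw [Nat.succ_mul] at this
    omega
  · intro j w
    simp only [Store.setMem, mix, Finset.mem_singleton, Prod.mk.injEq, Function.update_apply]
    by_cases hjw : j = i ∧ w = v
    · rw [if_pos hjw, if_pos (by rw [hjw.1, hjw.2])]
    · rw [if_neg hjw, if_neg, h.color]
      intro heq
      have := cell_inj w.2 v.2 (by omega : j.val * n + w.val = i.val * n + v.val)
      exact hjw ⟨Fin.ext this.1, Fin.ext this.2⟩

/-- Draw new colors for the vertices with indices `0, …, len - 1`, in the coloring at
address `reg 5`; the value of `vert` is the vertex with index `reg 6`. -/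
def drawRow (len vert : Expr) : Cmd :=
  .while (.reg 6) len <| .seq drawColor <|
    .seq (.store (.plus (.reg 5) vert) (.reg 7)) (.assign 6 (.plus (.reg 6) (.lit 1)))

/-- The expressions `len` and `vert` describe the list `l` of vertices. -/
structure Describes (L : List (List (Fin n))) (k p r x e : ℕ) (len vert : Expr)
    (l : List (Fin n)) : Prop where
  len_eq : ∀ (X : Fin x → Fin n → Fin r) (s : Store), Encodes L k p X s.mem →
    len.eval s = l.length
  vert_eq : ∀ (X : Fin x → Fin n → Fin r) (s : Store), Encodes L k p X s.mem → s.reg 3 = e →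
    ∀ (a : ℕ) (ha : a < l.length), s.reg 6 = a → vert.eval s = l[a].val

theorem ert_drawRow_le [NeZero r] (hL : ∀ l ∈ L, l.length = k) {e : ℕ} {len vert : Expr}
    {l : List (Fin n)} (hl : Describes L k p r x e len vert l) {i : Fin x} {s : Store}
    {X : Fin x → Fin n → Fin r} (hX : Encodes L k p X s.mem) (h3 : s.reg 3 = e)
    (h5 : s.reg 5 = 6 + L.length * k + i.val * n) (h6 : s.reg 6 = 0)
    {f : Store → ℝ≥0∞} {G : (Fin x → Fin n → Fin r) → ℝ≥0∞}
    (hf : ∀ X' s', Encodes L k p X' s'.mem → (∀ q < 6, s'.reg q = s.reg q) → f s' ≤ G X') :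
    ert (drawRow len vert) f s ≤ ((l.length * (12 * Nat.clog 2 r + 21) + 1 : ℕ) : ℝ≥0∞) +
      refresh ({i} ×ˢ l.toFinset) G X := by
  have := ert_while_le (f := f) (a := .reg 6) (b := len)
    (c := .seq drawColor <|
      .seq (.store (.plus (.reg 5) vert) (.reg 7)) (.assign 6 (.plus (.reg 6) (.lit 1))))
    (fun (y : ℕ × (Fin x → Fin n → Fin r)) s' => Encodes L k p y.2 s'.mem ∧
      (∀ q < 6, s'.reg q = s.reg q) ∧ s'.reg 6 = y.1 ∧ y.1 ≤ l.length)
    (fun y => (((l.length - y.1) * (12 * Nat.clog 2 r + 21) + 1 : ℕ) : ℝ≥0∞) +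
      refresh ({i} ×ˢ (l.drop y.1).toFinset) G y.2)
    ?_ ?_ (i := (0, X)) (s := s) ⟨hX, fun _ _ => rfl, h6, Nat.zero_le _⟩
  · simpa [drawRow] using this
  · rintro ⟨a, Y⟩ s' ⟨g1, g2, g3, g4⟩ hg
    simp only [Expr.eval, g3, hl.len_eq Y s' g1] at hg
    simp only at g3 g4 g1
    have ha : l.length = a := by omega
    have hdrop : ({i} ×ˢ (l.drop a).toFinset : Finset (Fin x × Fin n)) = ∅ := by
      rw [List.drop_of_length_le ha.le]
      simp
    simp only [hdrop, refresh_empty, ha, Nat.sub_self, zero_mul, zero_add, Nat.cast_one]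
    gcongr
    exact hf Y s' g1 g2
  · rintro ⟨a, Y⟩ s' ⟨g1, g2, g3, g4⟩ hg g hgV
    simp only [Expr.eval, g3, hl.len_eq Y s' g1] at hg
    simp only at g3 g4 g1 hg
    set W : (Fin x → Fin n → Fin r) → ℝ≥0∞ := fun Z =>
      (((l.length - (a + 1)) * (12 * Nat.clog 2 r + 21) + 4 : ℕ) : ℝ≥0∞) +
        refresh ({i} ×ˢ (l.drop (a + 1)).toFinset) G Z with hW
    have hr0 : 0 < r := Nat.pos_of_ne_zero (NeZero.ne r)
    have hdraw := ert_drawColor_le (s := s') g1.r_eq hr0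
      (f := ert (.seq (.store (.plus (.reg 5) vert) (.reg 7))
        (.assign 6 (.plus (.reg 6) (.lit 1)))) g)
      -- Numbers drawn are below `r`, so the reduction in `Fin.ofNat` never changes them.
      (G := fun u => W (mix {(i, l[a])} (fun _ _ => Fin.ofNat r u) Y)) ?_
    · rw [← Fin.sum_univ_eq_sum_range
        (fun u => W (mix {(i, l[a])} (fun _ _ => Fin.ofNat r u) Y))] at hdraw
      simp only [Fin.ofNat_val_eq_self] at hdraw
      rw [← refresh_singleton i l[a] W Y, hW, refresh_const_add] at hdraw
      -- Drawing vertex after vertex composes to one joint refresh of the row.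
      have hcomp : refresh {(i, l[a])} (refresh ({i} ×ˢ (l.drop (a + 1)).toFinset) G) Y =
          refresh ({i} ×ˢ (l.drop a).toFinset) G Y := by
        rw [refresh_refresh, ← List.cons_getElem_drop_succ (h := hg), List.toFinset_cons,
          Finset.insert_eq, Finset.product_union, Finset.singleton_product_singleton]
      rw [ert]
      refine (add_le_add le_rfl (add_le_add le_rfl hdraw)).trans (le_of_eq ?_)
      rw [← hcomp]
      have hN : l.length - a = l.length - (a + 1) + 1 := by omega
      simp only [hN]
      simp only [refresh]
      push_cast
      ring
    · intro u s'' hu hA h7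
      have hvert : vert.eval s'' = l[a].val := hl.vert_eq Y s'' (hA.mem ▸ g1)
        (by rw [hA.reg 3 (by omega), g2 3 (by omega), h3]) a hg
        (by rw [hA.reg 6 (by omega), g3])
      have h5' : s''.reg 5 = 6 + L.length * k + i.val * n := by
        rw [hA.reg 5 (by omega), g2 5 (by omega), h5]
      simp only [ert, Expr.eval, hvert, h5', h7]
      have hu' : (Fin.ofNat r u).val = u := Nat.mod_eq_of_lt hu
      have hE := Encodes.setMem (s := s'') (hA.mem ▸ g1 : Encodes L k p Y s''.mem) hL i l[a]
        (Fin.ofNat r u)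
      rw [hu'] at hE
      have := hgV (a + 1, mix {(i, l[a])} (fun _ _ => Fin.ofNat r u) Y)
        ((s''.setMem (6 + L.length * k + i.val * n + l[a].val) u).setReg 6
          ((s''.setMem (6 + L.length * k + i.val * n + l[a].val) u).reg 6 + 1))
        ⟨hE, fun q hq => ?_, ?_, hg⟩
      · refine (add_le_add le_rfl (add_le_add le_rfl (add_le_add le_rfl this))).trans
          (le_of_eq ?_)
        simp only [hW]
        push_cast
        ring
      · rw [Store.reg_setReg, if_neg (by omega), Store.reg_setMem, hA.reg q (by omega), g2 q hq]
      · simp [hA.reg 6, g3]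

/-- Draw new colors for the vertices described by `len` and `vert` in all colorings. -/
def drawAll (len vert : Expr) : Cmd :=
  .seq (.assign 4 (.lit 0)) <| .seq (.assign 5 (.reg 0)) <|
  .while (.reg 4) (.load (.lit 5)) <| .seq (.assign 6 (.lit 0)) <| .seq (drawRow len vert) <|
    .seq (.assign 5 (.plus (.reg 5) (.load (.lit 0)))) (.assign 4 (.plus (.reg 4) (.lit 1)))

/-- The rows `i, …, x - 1` of the cells of the vertices in `B`. -/
def rowsFrom {n : ℕ} (x i : ℕ) (B : Finset (Fin n)) : Finset (Fin x × Fin n) :=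
  (Finset.univ.filter fun j : Fin x => i ≤ j.val) ×ˢ B

theorem rowsFrom_succ {i : ℕ} (hi : i < x) (B : Finset (Fin n)) :
    rowsFrom x i B = {⟨i, hi⟩} ×ˢ B ∪ rowsFrom x (i + 1) B := by
  ext ⟨j, v⟩
  simp only [rowsFrom, Finset.mem_union, Finset.mem_product, Finset.mem_filter, Finset.mem_univ,
    true_and, Finset.mem_singleton, Fin.ext_iff]
  rw [← or_and_right]
  refine and_congr_left fun _ => ?_
  omega

theorem ert_drawAll_le [NeZero r] (hL : ∀ l ∈ L, l.length = k) {e : ℕ} {len vert : Expr}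
    {l : List (Fin n)} (hl : Describes L k p r x e len vert l) {s : Store}
    {X : Fin x → Fin n → Fin r} (hX : Encodes L k p X s.mem) (h3 : s.reg 3 = e)
    (h0 : s.reg 0 = 6 + L.length * k)
    {f : Store → ℝ≥0∞} {G : (Fin x → Fin n → Fin r) → ℝ≥0∞}
    (hf : ∀ X' s', Encodes L k p X' s'.mem → (∀ q < 4, s'.reg q = s.reg q) → f s' ≤ G X') :
    ert (drawAll len vert) f s ≤
      ((x * (l.length * (12 * Nat.clog 2 r + 21) + 8) + 5 : ℕ) : ℝ≥0∞) +
      refresh (cells x l.toFinset) G X := by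
  set T := l.length * (12 * Nat.clog 2 r + 21) with hT
  have := ert_while_le (f := f) (a := .reg 4) (b := .load (.lit 5))
    (c := .seq (.assign 6 (.lit 0)) <| .seq (drawRow len vert) <|
      .seq (.assign 5 (.plus (.reg 5) (.load (.lit 0)))) (.assign 4 (.plus (.reg 4) (.lit 1))))
    (fun (y : ℕ × (Fin x → Fin n → Fin r)) s' => Encodes L k p y.2 s'.mem ∧
      (∀ q < 4, s'.reg q = s.reg q) ∧ s'.reg 4 = y.1 ∧ y.1 ≤ x ∧
      s'.reg 5 = 6 + L.length * k + y.1 * n)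
    (fun y => (((x - y.1) * (T + 8) + 1 : ℕ) : ℝ≥0∞) +
      refresh (rowsFrom x y.1 l.toFinset) G y.2)
    ?_ ?_ (i := (0, X)) (s := (s.setReg 4 0).setReg 5 (s.reg 0))
    ⟨hX, fun q hq => ?_, by simp, Nat.zero_le _, by simp [h0]⟩
  · simp only [drawAll, ert, Expr.eval, Store.reg_setReg]
    simp only [ert] at this
    refine (add_le_add le_rfl (add_le_add le_rfl (add_le_add le_rfl
      (add_le_add le_rfl this)))).trans (le_of_eq ?_)
    have hall : rowsFrom x 0 l.toFinset = cells x l.toFinset := by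
      simp [rowsFrom, cells]
    simp only [hall, Nat.sub_zero]
    push_cast
    ring
  · rintro ⟨i, Y⟩ s' ⟨g1, g2, g3, g4, g5⟩ hg
    simp only [Expr.eval, g3, g1.x_eq] at hg
    simp only at g1 g3 g4 g5
    obtain rfl : i = x := by omega
    have hrows : rowsFrom i i l.toFinset = ∅ := by
      simp only [rowsFrom]
      rw [Finset.filter_false_of_mem fun j _ => by omega, Finset.empty_product]
    simp only [hrows, refresh_empty, Nat.sub_self, zero_mul, zero_add, Nat.cast_one]
    gcongr
    exact hf Y s' g1 g2
  · rintro ⟨i, Y⟩ s' ⟨g1, g2, g3, g4, g5⟩ hg g hgV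
    simp only [Expr.eval, g3, g1.x_eq] at hg
    simp only at g1 g3 g4 g5
    have hrow := ert_drawRow_le hL hl (i := ⟨i, hg⟩) (s := s'.setReg 6 0) (X := Y) g1
      (by simp [g2 3, h3]) (by simp [g5]) (by simp)
      (f := ert (.seq (.assign 5 (.plus (.reg 5) (.load (.lit 0))))
        (.assign 4 (.plus (.reg 4) (.lit 1)))) g)
      (G := fun Z => (((x - (i + 1)) * (T + 8) + 4 : ℕ) : ℝ≥0∞) +
        refresh (rowsFrom x (i + 1) l.toFinset) G Z) ?_
    · rw [refresh_const_add] at hrow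
      have hcomp : refresh ({⟨i, hg⟩} ×ˢ l.toFinset)
          (fun Z => refresh (rowsFrom x (i + 1) l.toFinset) G Z) Y =
          refresh (rowsFrom x i l.toFinset) G Y := by
        rw [rowsFrom_succ hg, ← refresh_refresh]
      rw [hcomp] at hrow
      rw [ert, ert, ert]
      refine (add_le_add le_rfl (add_le_add le_rfl (add_le_add le_rfl
        (add_le_add le_rfl hrow)))).trans (le_of_eq ?_)
      have hN : x - i = x - (i + 1) + 1 := by omega
      simp only [hN, hT]
      push_cast
      ring
    · intro Z s'' hZ hA
      simp only [ert, Expr.eval, hZ.n_eq, Store.reg_setReg]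
      have := hgV (i + 1, Z) ((s''.setReg 5 (s''.reg 5 + n)).setReg 4 (s''.reg 4 + 1))
        ⟨hZ, fun q hq => ?_, ?_, hg, ?_⟩
      · refine (add_le_add le_rfl (add_le_add le_rfl (add_le_add le_rfl this))).trans
          (le_of_eq ?_)
        push_cast
        ring
      · simp [hA q (by omega), g2 q hq, show q ≠ 4 by omega, show q ≠ 5 by omega,
          show q ≠ 6 by omega]
      · simp [hA 4, g3]
      · simp [hA 5, g5]
        ring
  · simp [show q ≠ 4 by omega, show q ≠ 5 by omega]

/-! ### The program -/

/-- Put the address of the first color into `reg 0`. -/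
def setBase : Cmd :=
  .seq (.assign 0 (.lit 6)) <| .seq (.assign 1 (.lit 0)) <|
  .while (.reg 1) (.load (.lit 1)) <|
    .seq (.assign 0 (.plus (.reg 0) (.load (.lit 2)))) (.assign 1 (.plus (.reg 1) (.lit 1)))

theorem det_setBase (s : Store) {m k : ℕ} (hm : s.mem 1 = m) (hk : s.mem 2 = k) :
    Det setBase s (4 * m + 5) fun s' => s'.mem = s.mem ∧ s'.reg 0 = 6 + m * k := by
  refine Det.mono (Det.assign_seq (Det.assign_seq (Det.while (N := m) (T := 3)
    (fun j s' => s'.mem = s.mem ∧ s'.reg 1 = j ∧ j ≤ m ∧ s'.reg 0 = 6 + j * k) ?_ ?_ ?_ ?_)))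
    (le_of_eq (by ring)) ?_
  · exact fun j s' h => h.2.2.1
  · rintro j s' ⟨h1, h2, h3, h4⟩
    simp only [Expr.eval, h1, h2, hm]
  · rintro j s' hj ⟨h1, h2, h3, h4⟩
    refine Det.assign_seq (Det.assign ⟨by simp [h1], by simp [Expr.eval, h2], hj, ?_⟩)
    simp [Expr.eval, h1, h4, hk]
    ring
  · exact ⟨rfl, by simp [Expr.eval], Nat.zero_le _, by simp [Expr.eval]⟩
  · rintro s' ⟨h1, h2, h3, h4⟩
    exact ⟨h1, h4⟩

/-- Redraw the colors of violated hyperedges until there are none. -/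
def repair : Cmd :=
  .while (.lit 0) (.reg 2) <| .seq findBad <|
    .ite (.lit 0) (.reg 2) (drawAll (.load (.lit 2)) (.load (.plus (.reg 3) (.reg 6))))
      (.assign 2 (.lit 0))

/-- Algorithm MTC. -/
def coverProgram : Cmd :=
  .seq setBase <| .seq (drawAll (.load (.lit 0)) (.reg 6)) <| .seq (.assign 2 (.lit 1)) repair

theorem describes_all (L : List (List (Fin n))) (k p r x e : ℕ) :
    Describes L k p r x e (.load (.lit 0)) (.reg 6) (List.finRange n) where
  len_eq X s h := by simp [Expr.eval, h.n_eq]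
  vert_eq X s h _ a ha ha' := by simp [Expr.eval, ha']

theorem describes_edge (hL : ∀ l ∈ L, l.length = k) {j : ℕ} (hj : j < L.length) :
    Describes L k p r x (6 + j * k) (.load (.lit 2)) (.load (.plus (.reg 3) (.reg 6))) L[j] where
  len_eq X s h := by simp [Expr.eval, h.k_eq, hL _ (List.getElem_mem hj)]
  vert_eq X s h he a ha ha' := by simp only [Expr.eval, he, ha', h.edge j hj a ha]

theorem badAt_iff {X : Fin x → Fin n → Fin r} {mem : ℕ → ℕ} (h : Encodes L k p X mem)
    (hL : ∀ l ∈ L, l.length = k) (hnd : ∀ l ∈ L, l.Nodup) (hpk : p ≤ k) {j : ℕ}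
    (hj : j < L.length) :
    BadAt mem n k p x (6 + L.length * k) (6 + j * k) ↔ Bad p X L[j].toFinset := by
  have hlen : L[j].length = k := hL _ (List.getElem_mem hj)
  have hcol : ∀ i : Fin x, ∀ (t : ℕ) (ht : t < L[j].length),
      mem (6 + L.length * k + i.val * n + mem (6 + j * k + t)) = (X i L[j][t]).val := by
    intro i t ht
    rw [h.edge j hj t ht, h.color]
  have hdist : ∀ i : Fin x,
      distinct (fun t => mem (6 + L.length * k + i.val * n + mem (6 + j * k + t))) k =
        (L[j].toFinset.image (X i)).card := by
    intro i
    -- The machine sees colors as natural numbers; the injection `Fin.val` preserves their number.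
    rw [distinct, ← Finset.card_image_of_injective _ Fin.val_injective]
    congr 1
    ext c
    simp only [Finset.mem_image, Finset.mem_range, List.mem_toFinset]
    constructor
    · rintro ⟨t, ht, rfl⟩
      exact ⟨_, ⟨L[j][t], List.getElem_mem _, rfl⟩, (hcol i t (hlen ▸ ht)).symm⟩
    · rintro ⟨_, ⟨v, hv, rfl⟩, rfl⟩
      obtain ⟨t, ht, rfl⟩ := List.mem_iff_getElem.1 hv
      exact ⟨t, hlen ▸ ht, hcol i t ht⟩
  have hcard : L[j].toFinset.card = k := by
    rw [List.toFinset_card_of_nodup (hnd _ (List.getElem_mem hj)), hlen]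
  simp only [BadAt, Bad, ProperlyColored, hcard, min_eq_left hpk, not_le]
  constructor
  · exact fun hb i => hdist i ▸ hb i i.2
  · exact fun hb i hi => (hdist ⟨i, hi⟩).symm ▸ hb ⟨i, hi⟩

/-- The cost of searching for a violated hyperedge. -/
def findCost {R : Type*} [CommSemiring R] (m k x : R) : R :=
  m * (x * (k * (5 * k + 10) + 13) + 17) + 7

/-- The cost of drawing new colors for `l` vertices. -/
def drawCost {R : Type*} [CommSemiring R] (l x b : R) : R :=
  x * (l * (12 * b + 21) + 8) + 5

/-- The cost of the whole program. -/
def programCost {R : Type*} [CommSemiring R] (n m k x b : R) : R :=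
  (4 * m + 5) + drawCost n x b + m * (findCost m k x + drawCost k x b + 3) + findCost m k x + 10

/-- One iteration that redraws costs `F + D + 3`, and the drift of the potential pays for it; `F +
5` covers the last, unsuccessful search and the exit. The Boolean of the ghost state is the flag in
register 2, and it is cleared only once a cover is certified. -/
theorem ert_repair_le [NeZero r] {E : Finset (Finset (Fin n))}
    (h : DependencyCondition E k r p x) (hP : Presents L E) (hL : ∀ l ∈ L, l.length = k)
    {f : Store → ℝ≥0∞}
    (hf : ∀ (X : Fin x → Fin n → Fin r) s, Encodes L k p X s.mem →
      s.reg 0 = 6 + L.length * k → IsStrongCover E p (Set.range X) → f s = 0)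
    {X : Fin x → Fin n → Fin r} {s : Store} (hX : Encodes L k p X s.mem)
    (h0 : s.reg 0 = 6 + L.length * k) (h2 : s.reg 2 = 1) :
    ert repair f s ≤
      ((findCost L.length k x + drawCost k x (Nat.clog 2 r) + 3 : ℕ) : ℝ≥0∞) * potential E p X +
        ((findCost L.length k x + 5 : ℕ) : ℝ≥0∞) := by
  obtain ⟨hnd, -, hE⟩ := hP
  have hmem : ∀ (j : ℕ) (hj : j < L.length), L[j].toFinset ∈ E := fun j hj => by
    rw [← hE, List.mem_toFinset]
    exact List.mem_map_of_mem (List.getElem_mem hj)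
  set F := findCost L.length k x with hF
  set D := drawCost k x (Nat.clog 2 r) with hD
  set V : (Fin x → Fin n → Fin r) × Bool → ℝ≥0∞ := fun y => if y.2 then
    ((F + D + 3 : ℕ) : ℝ≥0∞) * potential E p y.1 + ((F + 5 : ℕ) : ℝ≥0∞) else 1 with hV
  have := ert_while_le (f := f) (a := .lit 0) (b := .reg 2) (c := .seq findBad <|
    .ite (.lit 0) (.reg 2) (drawAll (.load (.lit 2)) (.load (.plus (.reg 3) (.reg 6))))
      (.assign 2 (.lit 0)))
    (fun (y : (Fin x → Fin n → Fin r) × Bool) s' => Encodes L k p y.1 s'.mem ∧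
      s'.reg 0 = 6 + L.length * k ∧ s'.reg 2 = y.2.toNat ∧
      (y.2 = false → IsStrongCover E p (Set.range y.1)))
    V ?_ ?_ (i := (X, true)) (s := s) ⟨hX, h0, h2, by simp⟩
  · simpa [hV, repair] using this
  · rintro ⟨Y, t⟩ s' ⟨g1, g2, g3, g4⟩ hg
    simp only [Expr.eval, g3] at hg
    have ht : t = false := by
      cases t
      · rfl
      · simp at hg
    rw [hf Y s' g1 g2 (g4 ht), hV]
    simp [ht]
  · rintro ⟨Y, t⟩ s' ⟨g1, g2, g3, g4⟩ hg g hgV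
    simp only [Expr.eval, g3] at hg
    simp only at g1 g2
    have ht : t = true := by
      cases t
      · simp at hg
      · rfl
    rw [ert]
    have hb : ∀ j (hj : j < L.length), BadAt s'.mem n k p x (s'.reg 0) (6 + j * k) ↔
        Bad p Y L[j].toFinset := fun j hj => by
      rw [g2]
      exact badAt_iff g1 hL hnd h.p_le_k hj
    have hfind := det_findBad s' g1.n_eq g1.m_eq g1.k_eq g1.p_eq g1.x_eq
      (ert (.ite (.lit 0) (.reg 2) (drawAll (.load (.lit 2)) (.load (.plus (.reg 3) (.reg 6))))
      (.assign 2 (.lit 0))) g)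
      (((F + D + 3 : ℕ) : ℝ≥0∞) * potential E p Y + 3) ?_
    · refine (add_le_add le_rfl (add_le_add le_rfl hfind)).trans (le_of_eq ?_)
      simp only [hV, ht, if_true, hF, findCost]
      push_cast
      ring
    · rintro s'' ⟨e1, e2, ⟨e3, e4⟩ | ⟨e3, j, hj, e4, e5⟩⟩
      · have hcover : IsStrongCover E p (Set.range Y) := by
          rw [isStrongCover_iff]
          intro e he
          rw [← hE, List.mem_toFinset, List.mem_map] at he
          obtain ⟨l, hl, rfl⟩ := he
          obtain ⟨j, hj, rfl⟩ := List.mem_iff_getElem.1 hl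
          exact fun hbad => e4 j hj ((hb j hj).2 hbad)
        have hend := hgV (Y, false) (s''.setReg 2 0)
          ⟨(e1 ▸ g1 : Encodes L k p Y s''.mem), by simp [e2, g2], by simp, fun _ => hcover⟩
        simp only [ert, Expr.eval, e3, lt_irrefl, if_false]
        calc _ ≤ 1 + (1 + V (Y, false)) := by gcongr
          _ = 3 := by simp only [hV]; norm_num
          _ ≤ _ := le_add_self
      · have hdraw := ert_drawAll_le hL (describes_edge (p := p) (r := r) (x := x) hL hj)
          (s := s'') (X := Y) (e1 ▸ g1) e5 (by rw [e2, g2]) (f := g)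
          (G := fun Z => ((F + 5 : ℕ) : ℝ≥0∞) + ((F + D + 3 : ℕ) : ℝ≥0∞) * potential E p Z) ?_
        · have hne : L[j].toFinset.Nonempty := by
            rw [← Finset.card_pos, h.uniform _ (hmem j hj)]
            exact (zero_lt_two.trans_le h.two_le_p).trans_le h.p_le_k
          have hpot := one_add_refresh_potential_le (hmem j hj) hne ((hb j hj).1 e4)
          rw [refresh_const_add, refresh_const_mul, hL _ (List.getElem_mem hj)] at hdraw
          have hg' : (Expr.lit 0).eval s'' < (Expr.reg 2).eval s'' := by simp [Expr.eval, e3]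
          simp only [ert, if_pos hg']
          refine (add_le_add le_rfl hdraw).trans ?_
          refine le_trans (le_of_eq ?_) (add_le_add (mul_le_mul_right hpot _) le_rfl)
          rw [hD, drawCost]
          push_cast
          ring
        · intro Z s₃ hZ hA
          refine (hgV (Z, true) s₃ ⟨hZ, by rw [hA 0 (by omega), e2, g2],
            by rw [hA 2 (by omega), e3]; rfl, by simp⟩).trans (le_of_eq ?_)
          simp only [hV, if_true]
          exact add_comm _ _

/-! ### The input word and the cost of the whole program -/

theorem getElem?_flatten_of_length_eq {α : Type*} {L : List (List α)} {k : ℕ}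
    (hL : ∀ l ∈ L, l.length = k) {j : ℕ} (hj : j < L.length) {a : ℕ} (ha : a < L[j].length) :
    L.flatten[j * k + a]? = some L[j][a] := by
  induction L generalizing j with
  | nil => simp at hj
  | cons l L ih =>
    have hl := hL l (by simp)
    rw [List.flatten_cons]
    cases j with
    | zero =>
      rw [zero_mul, zero_add, List.getElem?_append_left (by simpa using ha)]
      simp
    | succ j =>
      rw [List.getElem?_append_right (by rw [hl, Nat.succ_mul]; omega)]
      have hidx : (j + 1) * k + a - l.length = j * k + a := by
        rw [hl, Nat.succ_mul]
        omega
      rw [hidx]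
      exact ih (fun l' hl' => hL l' (by simp [hl'])) (by simpa using hj) ha

/-- Memory beyond the input word reads as 0, that is, color 0 everywhere. This family is a
placeholder to which the rule for drawing applies; it is overwritten entirely. -/
theorem encodes_initial [NeZero r] (hL : ∀ l ∈ L, l.length = k) :
    Encodes L k p (fun (_ : Fin x) (_ : Fin n) => (0 : Fin r))
      (initial (inputWord L k r p x)).mem where
  n_eq := rfl
  m_eq := rfl
  k_eq := rfl
  r_eq := rfl
  p_eq := rfl
  x_eq := rfl
  edge j hj a ha := by
    have h6 : 6 + j * k + a = j * k + a + 6 := by ring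
    simp only [initial, inputWord, List.getD_eq_getElem?_getD, h6, List.cons_append,
      List.nil_append, List.getElem?_cons_succ, List.getElem?_map,
      getElem?_flatten_of_length_eq hL hj ha]
    rfl
  color i v := by
    have hlen : L.flatten.length = L.length * k := by
      rw [List.length_flatten, List.map_congr_left hL, List.map_const', List.sum_replicate,
        smul_eq_mul]
    simp only [initial, inputWord, List.getD_eq_getElem?_getD]
    rw [List.getElem?_eq_none]
    · simp
    · simp only [List.length_append, List.length_cons, List.length_nil, List.length_map, hlen]
      omega

open Classical in
theorem ert_coverProgram_le [NeZero r] {E : Finset (Finset (Fin n))}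
    (h : DependencyCondition E k r p x) (hP : Presents L E) (hL : ∀ l ∈ L, l.length = k) :
    ert coverProgram (fun s => if OutputsStrongCover E r p x s then 0 else ⊤)
      (initial (inputWord L k r p x)) ≤
      (programCost n L.length k x (Nat.clog 2 r) : ℕ) := by
  set s₀ := initial (inputWord L k r p x) with hs₀
  set f : Store → ℝ≥0∞ := fun s => if OutputsStrongCover E r p x s then 0 else ⊤ with hf
  have hX₀ := encodes_initial (r := r) (x := x) (p := p) hL
  rw [← hs₀] at hX₀
  set F := findCost L.length k x with hF
  set D := drawCost k x (Nat.clog 2 r) with hD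
  have hm : E.card = L.length := by
    rw [← hP.2.2, List.toFinset_card_of_nodup hP.2.1, List.length_map]
  have hend : ∀ (X : Fin x → Fin n → Fin r) s, Encodes L k p X s.mem →
      s.reg 0 = 6 + L.length * k → IsStrongCover E p (Set.range X) → f s = 0 := by
    intro X s hX h0 hc
    refine if_pos ⟨X, fun i v => ?_, hc⟩
    rw [h0, ← add_assoc, hX.color]
  have hbase := det_setBase s₀ hX₀.m_eq hX₀.k_eq
    (ert (.seq (drawAll (.load (.lit 0)) (.reg 6)) (.seq (.assign 2 (.lit 1)) repair)) f)
    (((drawCost n x (Nat.clog 2 r) : ℕ) : ℝ≥0∞) +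
      (((F + D + 3 : ℕ) : ℝ≥0∞) * L.length + ((F + 8 : ℕ) : ℝ≥0∞))) ?_
  · rw [coverProgram, ert]
    refine (add_le_add le_rfl hbase).trans ?_
    have : 1 + (4 * L.length + 5) + (drawCost n x (Nat.clog 2 r) +
        ((F + D + 3) * L.length + (F + 8))) ≤ programCost n L.length k x (Nat.clog 2 r) := by
      rw [programCost, ← hF, ← hD]
      linarith [mul_comm (F + D + 3) L.length]
    refine le_trans (le_of_eq ?_) (Nat.cast_le.2 this)
    push_cast
    ring
  · rintro s ⟨h1, h2⟩
    have hdraw := ert_drawAll_le hL (describes_all L k p r x (s.reg 3)) (s := s)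
      (h1 ▸ hX₀) rfl h2 (f := ert (.seq (.assign 2 (.lit 1)) repair) f)
      (G := fun Z => ((F + 7 : ℕ) : ℝ≥0∞) + ((F + D + 3 : ℕ) : ℝ≥0∞) * potential E p Z) ?_
    -- The first draw refreshes all cells, which turns the potential into its mean, at most the
    -- number of hyperedges.
    · have huniv : cells x (List.finRange n).toFinset = Finset.univ := by
        ext ⟨i, v⟩
        simp [mem_cells]
      rw [refresh_const_add, refresh_const_mul, huniv, refresh_univ, List.length_finRange] at hdraw
      have hpot := mean_potential_le_card h
      rw [hm] at hpot
      rw [ert]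
      refine (add_le_add le_rfl hdraw).trans ?_
      calc _ ≤ 1 + (((drawCost n x (Nat.clog 2 r) : ℕ) : ℝ≥0∞) + (((F + 7 : ℕ) : ℝ≥0∞) +
            ((F + D + 3 : ℕ) : ℝ≥0∞) * L.length)) := by
            gcongr
            exact le_rfl
        _ = _ := by
            push_cast
            ring
    · intro Z s' hZ hA
      have := ert_repair_le h hP hL hend (X := Z) (s := s'.setReg 2 1) hZ
        (by simp [hA 0, h2]) (by simp)
      simp only [ert, Expr.eval]
      refine (add_le_add le_rfl (add_le_add le_rfl this)).trans (le_of_eq ?_)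
      push_cast
      ring

/-- Without hyperedges `k` is not bounded by the instance size, but then it also drops out of the
cost, so it may be replaced by 0. -/
theorem programCost_mono {n m k x b N : ℕ} (hn : n ≤ N) (hm : m ≤ N) (hk : 0 < m → k ≤ N)
    (hx : x ≤ N) (hb : b ≤ N) : programCost n m k x b ≤ programCost N N N N N := by
  obtain ⟨k', hk', h⟩ : ∃ k' ≤ N, programCost n m k x b = programCost n m k' x b := by
    rcases Nat.eq_zero_or_pos m with rfl | hm0
    · exact ⟨0, Nat.zero_le _, by simp [programCost, findCost]⟩
    · exact ⟨k, hk hm0, rfl⟩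
  rw [h]
  unfold programCost findCost drawCost
  gcongr

open Polynomial in
theorem eval_programCost (N : ℕ) :
    (programCost X X X X X : ℕ[X]).eval N = programCost N N N N N := by
  simp [programCost, findCost, drawCost]

theorem coverProgram_spec {E : Finset (Finset (Fin n))}
    (h : DependencyCondition E k r p x) (hP : Presents L E) :
    expectedTime coverProgram (initial (inputWord L k r p x)) ≤
      (programCost (instanceSize n E.card x r) (instanceSize n E.card x r)
        (instanceSize n E.card x r) (instanceSize n E.card x r) (instanceSize n E.card x r) : ℕ) ∧
    ∀ s, CanHaltIn coverProgram (initial (inputWord L k r p x)) s →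
      OutputsStrongCover E r p x s := by
  classical
  have : NeZero r := ⟨by have := h.two_le_p; have := h.p_le_r; omega⟩
  have hL : ∀ l ∈ L, l.length = k := fun l hl => by
    rw [← List.toFinset_card_of_nodup (hP.1 l hl)]
    refine h.uniform _ ?_
    rw [← hP.2.2, List.mem_toFinset]
    exact List.mem_map_of_mem hl
  have hm : E.card = L.length := by
    rw [← hP.2.2, List.toFinset_card_of_nodup hP.2.1, List.length_map]
  have hert := ert_coverProgram_le h hP hL
  refine ⟨(expectedTime_le _ _ _).trans (hert.trans (Nat.cast_le.2 ?_)), fun s hs =>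
    of_canHaltIn (ne_top_of_le_ne_top (ENNReal.natCast_ne_top _) hert) hs⟩
  have hk : 0 < L.length → k ≤ n := fun h0 => by
    rw [← hL _ (List.getElem_mem h0)]
    simpa using (hP.1 _ (List.getElem_mem h0)).length_le_card
  have hb : Nat.clog 2 r ≤ r.size := Nat.clog_le_of_le_pow (Nat.lt_size_self r).le
  rw [hm]
  unfold instanceSize
  refine programCost_mono (by omega) (by omega) (fun h0 => ?_) (by omega) (by omega)
  have := hk h0
  omega

end RAM

theorem mainTheorem3 :
    -- existence
    (∀ (V : Type*) [Fintype V] [DecidableEq V] (E : Finset (Finset V)) (k r p x : ℕ),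
      DependencyCondition E k r p x → strongCoverNumber E r p ≤ (x : ℕ∞)) ∧
    -- Algorithm MTC, with any choice of the violated hyperedges, stops after an expected
    -- polynomial number of resamplings
    (∃ q : Polynomial ℕ,
      ∀ (V : Type*) [Fintype V] [DecidableEq V] (E : Finset (Finset V)) (k r p x : ℕ) [NeZero r]
        (pick : List (Fin x → V → Fin r) → (Fin x → V → Fin r) → Finset V),
        DependencyCondition E k r p x → MTC.IsSelectionRule E p pick →
        MTC.expectedRounds E p pick ≤
          (q.eval (instanceSize (Fintype.card V) E.card x r) : ℕ)) ∧
    -- a randomized machine computes such a cover, without error, in expected polynomial time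
    (∃ (M : RAM.Cmd) (q : Polynomial ℕ),
      ∀ (n : ℕ) (E : Finset (Finset (Fin n))) (k r p x : ℕ) (L : List (List (Fin n))),
        DependencyCondition E k r p x → Presents L E →
        RAM.expectedTime M (RAM.initial (inputWord L k r p x)) ≤
          (q.eval (instanceSize n E.card x r) : ℕ) ∧
        ∀ s, RAM.CanHaltIn M (RAM.initial (inputWord L k r p x)) s →
          OutputsStrongCover E r p x s) := by
  refine ⟨fun V _ _ E k r p x h => MTC.strongCoverNumber_le h,
    -- The bound on the rounds is `|E|`, itself a summand of the instance size.
    ⟨Polynomial.X, fun V _ _ E k r p x _ pick h hpick => ?_⟩,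
    ⟨RAM.coverProgram, RAM.programCost Polynomial.X Polynomial.X Polynomial.X Polynomial.X
      Polynomial.X, fun n E k r p x L h hP => ?_⟩⟩
  · refine (MTC.expectedRounds_le h hpick).trans (Nat.cast_le.2 ?_)
    rw [Polynomial.eval_X, instanceSize]
    omega
  · rw [RAM.eval_programCost]
    exact RAM.coverProgram_spec h hP
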